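/- Let $n>2$. For $z\in\mathbb{C}^n$ (row vector) put $zz^t=z_1^2+\cdots+z_n^2$, and let $$\mathscr{D}=\{z\in\mathbb{C}^n : 1-2|z|^2+|zz^t|^2>0,\ |z|<1\}$$ be the Lie ball, $\mathscr{X}=\mathscr{D}\cap\mathbb{R}^n$ its real part (which is the open unit ball of $\mathbb{R}^n$), and $M=\{Z\in M_{n2}(\mathbb{R}) : Z^tZ<I_2\}$. The Hua transform is $$\mathcal{H}(z)=2\left(\begin{pmatrix} zz^t+1 & i(zz^t-1)\\ \overline{zz^t}+1 & -i(\overline{zz^t}-1)\end{pmatrix}^{-1}\begin{pmatrix} z\\ \overline z\end{pmatrix}\right)^t ,$$ a real $n\times 2$ matrix. For $p\in\{1,2\}$ let $SO(p,n)$ be the group of real matrices of determinant $1$ preserving $x_1y_1+\cdots+x_py_p-x_{p+1}y_{p+1}-\cdots-x_{p+n}y_{p+n}$, and let $SO_0(p,n)$ be its identity component. An element $\begin{pmatrix}A&B\\C&D\end{pmatrix}$ of $SO(2,n)$ acts on $M$ by $Z\mapsto (C+DZ)(A+BZ)^{-1}$, and $SO(1,n)$ is embedded in $SO(2,n)$ by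 $$\theta:\begin{pmatrix}a&b\\c&D\end{pmatrix}\mapsto\begin{pmatrix}a&0&b\\0&1&0\\c&0&D\end{pmatrix}.$$ Let $\mathrm{Aut}(\mathscr{D})$ be the group of biholomorphic self-maps of $\mathscr{D}$ with the compact-open topology, $G$ its identity component, and $H$ the identity component (the connected component of the identity) of $\{h\in G : h(x)\in\mathscr{X}\text{ for all }x\in\mathscr{X}\}$. Then: 1. $\mathcal{H}$ is a bijection of $\mathscr{D}$ onto $M$, and it maps $\mathscr{X}$ diffeomorphically onto $\mathcal{H}(\mathscr{X})=\{(X\ 0) : X\in M_{n1}(\mathbb{R}),\ |X|<1\}$, by $x\mapsto \left(\frac{2x}{1+|x|^2}\ \ 0\right)$. 2. $H$ is a group, and $h\mapsto \mathcal{H}h\mathcal{H}^{-1}$ is an isomorphism of (topological) groups from $H$ onto $SO_0(1,n)$, acting on $M$ through $\theta$; that is, there is an isomorphism of topological groups $\Phi:H\to SO_0(1,n)$ with $\mathcal{H}(h(z))=\theta(\Phi(h))\cdot\mathcal{H}(z)$ for all $h\in H$, $z\in\mathscr{D}$. 3. The same holds if $G$ is taken to be $SO_0(2,n)$, acting on $\mathscr{D}$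 by $z\mapsto\mathcal{H}^{-1}(g\cdot\mathcal{H}(z))$: the identity component of $\{g\in SO_0(2,n) : \mathcal{H}^{-1}(g\cdot\mathcal{H}(x))\in\mathscr{X}\text{ for all }x\in\mathscr{X}\}$ is a subgroup, and $\theta$ restricts to an isomorphism of topological groups from $SO_0(1,n)$ onto it. -/

import Mathlib

open scoped ContDiff Matrix ComplexConjugate

noncomputable section

namespace LieBall

/-! ### The Lie ball, its real part, and the group of its holomorphic automorphisms -/

/-- The quadratic form `z zᵗ = z₁² + ⋯ + zₙ²` on `ℂⁿ`. -/
def quad {n : ℕ} (z : EuclideanSpace ℂ (Fin n)) : ℂ := ∑ i, z i ^ 2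

/-- The Lie ball `𝓓 = {z ∈ ℂⁿ | 1 - 2⟨z,z⟩ + |z zᵗ|² > 0, |z| < 1}`. -/
def lieBall (n : ℕ) : Set (EuclideanSpace ℂ (Fin n)) :=
  {z | 0 < 1 - 2 * ‖z‖ ^ 2 + ‖quad z‖ ^ 2 ∧ ‖z‖ < 1}

/-- The inclusion `ℝⁿ ⊆ ℂⁿ`. -/
def ofRealVec {n : ℕ} (x : EuclideanSpace ℝ (Fin n)) : EuclideanSpace ℂ (Fin n) :=
  WithLp.toLp 2 fun i => (x i : ℂ)

/-- The real part `𝓧 = 𝓓 ∩ ℝⁿ`. -/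
def realPart (n : ℕ) : Set (EuclideanSpace ℂ (Fin n)) :=
  lieBall n ∩ Set.range ofRealVec

/-- A self-map of the Lie ball is holomorphic if it is the restriction of a function on `ℂⁿ` that
is complex differentiable on the (open) set `𝓓`. -/
def IsHolo {n : ℕ} (f : lieBall n → lieBall n) : Prop :=
  ∃ F : EuclideanSpace ℂ (Fin n) → EuclideanSpace ℂ (Fin n),
    DifferentiableOn ℂ F (lieBall n) ∧ ∀ z : lieBall n, F z = f z

/-- The group `Aut(𝓓)` of biholomorphic self-maps of the Lie ball, under composition. -/
def aut (n : ℕ) : Subgroup (lieBall n ≃ₜ lieBall n) where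
  carrier := {f | IsHolo f ∧ IsHolo f.symm}
  one_mem' := ⟨⟨id, differentiableOn_id, fun _ => rfl⟩, ⟨id, differentiableOn_id, fun _ => rfl⟩⟩
  inv_mem' := fun h => ⟨h.2, h.1⟩
  mul_mem' := by
    have key : ∀ f g : lieBall n → lieBall n, IsHolo f → IsHolo g → IsHolo (f ∘ g) := by
      rintro f g ⟨F, hF, hFf⟩ ⟨G, hG, hGg⟩
      refine ⟨F ∘ G, hF.comp hG fun z hz => ?_, fun z => ?_⟩
      · rw [hGg ⟨z, hz⟩]
        exact (g ⟨z, hz⟩).2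
      · simp [hGg z, hFf (g z)]
    rintro f g ⟨hf, hf'⟩ ⟨hg, hg'⟩
    exact ⟨key f g hf hg, key g.symm f.symm hg' hf'⟩

/-- `Aut(𝓓)` carries the compact-open topology. -/
instance (n : ℕ) : TopologicalSpace (aut n) :=
  TopologicalSpace.induced
    (fun f => (⟨f.1, f.1.continuous⟩ : C(lieBall n, lieBall n))) inferInstance

/-- The group `G`, as the identity component of `Aut(𝓓)`. -/
def autZero (n : ℕ) : Set (aut n) := connectedComponent 1

/-- The identity component of `{h ∈ G | h(x) ∈ 𝓧 if x ∈ 𝓧}`, where `G` is the identity component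
of `Aut(𝓓)`. -/
def groupH (n : ℕ) : Set (aut n) :=
  connectedComponentIn
    {h | h ∈ autZero n ∧ ∀ x : lieBall n, (x : EuclideanSpace ℂ (Fin n)) ∈ realPart n →
      (h.1 x : EuclideanSpace ℂ (Fin n)) ∈ realPart n} 1

/-! ### The groups `SO(p,q)` and `SO₀(p,q)` -/

/-- The form `(x|y) = x₁y₁ + ⋯ + x_p y_p - x_{p+1}y_{p+1} - ⋯ - x_{p+q}y_{p+q}`. -/
def form (p q : ℕ) (x y : Fin p ⊕ Fin q → ℝ) : ℝ :=
  ∑ i, x (Sum.inl i) * y (Sum.inl i) - ∑ j, x (Sum.inr j) * y (Sum.inr j)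

/-- The group `SO(p,q)` of real matrices of determinant one that preserve the form. -/
def SO (p q : ℕ) : Subgroup (Matrix.SpecialLinearGroup (Fin p ⊕ Fin q) ℝ) where
  carrier := {g | ∀ x y, form p q (g.1 *ᵥ x) (g.1 *ᵥ y) = form p q x y}
  one_mem' := by intro x y; simp
  mul_mem' := by
    intro g h hg hh x y
    have hg' := hg (h.1 *ᵥ x) (h.1 *ᵥ y)
    rw [hh x y] at hg'
    simpa [Matrix.mulVec_mulVec] using hg'
  inv_mem' := by
    intro g hg x y
    have hgi : g.1 * (g⁻¹).1 = 1 := by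
      rw [← Matrix.SpecialLinearGroup.coe_mul, mul_inv_cancel, Matrix.SpecialLinearGroup.coe_one]
    have h := hg ((g⁻¹).1 *ᵥ x) ((g⁻¹).1 *ᵥ y)
    rw [Matrix.mulVec_mulVec, Matrix.mulVec_mulVec, hgi, Matrix.one_mulVec,
      Matrix.one_mulVec] at h
    exact h.symm

/-- `SO₀(p,q)`, the identity component of `SO(p,q)`. -/
def SOZero (p q : ℕ) : Subgroup (SO p q) := Subgroup.connectedComponentOfOne (SO p q)

/-- The underlying matrix of an element of `SO(p,q)`. -/
def soMat {p q : ℕ} (g : SO p q) : Matrix (Fin p ⊕ Fin q) (Fin p ⊕ Fin q) ℝ := g.1.1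

/-- The matrix
`(a b; c D) ↦ (a 0 b; 0 1 0; c 0 D)` of size `2 + n`, for a matrix of size `1 + n`. -/
def thetaMat {n : ℕ} (g : Matrix (Fin 1 ⊕ Fin n) (Fin 1 ⊕ Fin n) ℝ) :
    Matrix (Fin 2 ⊕ Fin n) (Fin 2 ⊕ Fin n) ℝ :=
  Matrix.fromBlocks
    !![g (Sum.inl 0) (Sum.inl 0), 0; 0, 1]
    (Matrix.of ![fun j => g (Sum.inl 0) (Sum.inr j), fun _ => 0])
    (Matrix.of fun i => ![g (Sum.inr i) (Sum.inl 0), 0])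
    g.toBlocks₂₂

theorem thetaMat_mul {n : ℕ} (g h : Matrix (Fin 1 ⊕ Fin n) (Fin 1 ⊕ Fin n) ℝ) :
    thetaMat (g * h) = thetaMat g * thetaMat h := by
  ext i j
  rcases i with i | i <;> rcases j with j | j
  all_goals try fin_cases i
  all_goals try fin_cases j
  all_goals simp [thetaMat, Matrix.mul_apply, Matrix.toBlocks₂₂]

theorem thetaMat_one {n : ℕ} :
    thetaMat (1 : Matrix (Fin 1 ⊕ Fin n) (Fin 1 ⊕ Fin n) ℝ) = 1 := by
  ext i j
  rcases i with i | i <;> rcases j with j | j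
  all_goals try fin_cases i
  all_goals try fin_cases j
  all_goals simp [thetaMat, Matrix.toBlocks₂₂, Matrix.one_apply]

theorem thetaMat_det {n : ℕ} (g : Matrix (Fin 1 ⊕ Fin n) (Fin 1 ⊕ Fin n) ℝ) :
    (thetaMat g).det = g.det := by
  let e : Fin 2 ⊕ Fin n ≃ Fin 1 ⊕ (Fin 1 ⊕ Fin n) :=
    { toFun := Sum.elim ![Sum.inr (Sum.inl 0), Sum.inl 0] (fun j => Sum.inr (Sum.inr j))
      invFun := Sum.elim (fun _ => Sum.inl 1)
        (Sum.elim (fun _ => Sum.inl 0) (fun j => Sum.inr j))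
      left_inv := by
        rintro (i | i)
        · fin_cases i <;> rfl
        · rfl
      right_inv := by
        rintro (i | i | i)
        · fin_cases i; rfl
        · fin_cases i; rfl
        · rfl }
  have h : thetaMat g = (Matrix.fromBlocks (1 : Matrix (Fin 1) (Fin 1) ℝ) 0 0 g).submatrix e e := by
    ext i j
    rcases i with i | i <;> rcases j with j | j
    all_goals try fin_cases i
    all_goals try fin_cases j
    all_goals simp [thetaMat, e, Matrix.toBlocks₂₂]
  rw [h, Matrix.det_submatrix_equiv_self, Matrix.det_fromBlocks_zero₂₁, Matrix.det_one, one_mul]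

theorem thetaMat_form {n : ℕ} (g : Matrix (Fin 1 ⊕ Fin n) (Fin 1 ⊕ Fin n) ℝ)
    (hg : ∀ x y, form 1 n (g *ᵥ x) (g *ᵥ y) = form 1 n x y) (x y : Fin 2 ⊕ Fin n → ℝ) :
    form 2 n (thetaMat g *ᵥ x) (thetaMat g *ᵥ y) = form 2 n x y := by
  let r : (Fin 2 ⊕ Fin n → ℝ) → Fin 1 ⊕ Fin n → ℝ :=
    fun x => Sum.elim (fun _ => x (Sum.inl 0)) (fun j => x (Sum.inr j))
  have h0 : ∀ x, (thetaMat g *ᵥ x) (Sum.inl 0) = (g *ᵥ r x) (Sum.inl 0) := by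
    intro x
    simp [thetaMat, r, Matrix.mulVec, dotProduct]
  have h1 : ∀ x, (thetaMat g *ᵥ x) (Sum.inl 1) = x (Sum.inl 1) := by
    intro x
    simp [thetaMat, Matrix.mulVec, dotProduct]
  have h2 : ∀ x j, (thetaMat g *ᵥ x) (Sum.inr j) = (g *ᵥ r x) (Sum.inr j) := by
    intro x j
    simp [thetaMat, r, Matrix.mulVec, dotProduct, Matrix.toBlocks₂₂]
  have h := hg (r x) (r y)
  simp only [form, Fin.sum_univ_two, Finset.univ_unique, Finset.sum_singleton,
    Fin.default_eq_zero, h0, h1, h2] at h ⊢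
  simp only [r, Sum.elim_inl, Sum.elim_inr] at h ⊢
  linarith

/-- The embedding `θ : SO(1,n) → SO(2,n)`. -/
def theta (n : ℕ) : SO 1 n →* SO 2 n where
  toFun g := ⟨⟨thetaMat (soMat g), (thetaMat_det _).trans g.1.2⟩, thetaMat_form (soMat g) g.2⟩
  map_one' := Subtype.ext <| Subtype.ext thetaMat_one
  map_mul' g h := Subtype.ext <| Subtype.ext <| thetaMat_mul (soMat g) (soMat h)

/-! ### The matrix ball `M` and the action of `SO(2,n)` on it -/

/-- The set `M = {Z ∈ M_{n2}(ℝ) | Zᵗ Z < I₂}`. -/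
def matBall (n : ℕ) : Set (Matrix (Fin n) (Fin 2) ℝ) := {Z | (1 - Zᵀ * Z).PosDef}

/-- The fractional linear action `Z ↦ (C + D Z)(A + B Z)⁻¹` of a matrix `(A B; C D)`. -/
def mobius {p q : ℕ} (g : SO p q) (Z : Matrix (Fin q) (Fin p) ℝ) : Matrix (Fin q) (Fin p) ℝ :=
  ((soMat g).toBlocks₂₁ + (soMat g).toBlocks₂₂ * Z) * ((soMat g).toBlocks₁₁ + (soMat g).toBlocks₁₂ * Z)⁻¹

/-- The matrix `(X 0)` with columns `X` and `0`. -/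
def colZero {n : ℕ} (X : EuclideanSpace ℝ (Fin n)) : Matrix (Fin n) (Fin 2) ℝ :=
  Matrix.of fun i => ![X i, 0]

/-! ### The Hua transform -/

/-- The `2 × 2` matrix in the definition of the Hua transform. -/
def huaCoeff {n : ℕ} (z : EuclideanSpace ℂ (Fin n)) : Matrix (Fin 2) (Fin 2) ℂ :=
  !![quad z + 1, Complex.I * (quad z - 1);
     conj (quad z) + 1, -Complex.I * (conj (quad z) - 1)]

/-- The `2 × n` matrix with rows `z` and `z̄`. -/
def huaRows {n : ℕ} (z : EuclideanSpace ℂ (Fin n)) : Matrix (Fin 2) (Fin n) ℂ :=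
  Matrix.of ![fun j => z j, fun j => conj (z j)]

/-- The defining formula of the Hua transform, as a complex matrix. -/
def huaComplex {n : ℕ} (z : EuclideanSpace ℂ (Fin n)) : Matrix (Fin n) (Fin 2) ℂ :=
  (2 : ℂ) • ((huaCoeff z)⁻¹ * huaRows z)ᵀ

/-- The Hua transform `𝓗`, as a real matrix; see `huaComplex_eq_hua`. -/
def hua {n : ℕ} (z : EuclideanSpace ℂ (Fin n)) : Matrix (Fin n) (Fin 2) ℝ :=
  (huaComplex z).map Complex.re

/-- The formula for the Hua transform has real entries. -/
theorem huaComplex_eq_hua {n : ℕ} (z : EuclideanSpace ℂ (Fin n)) :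
    huaComplex z = (hua z).map (fun r : ℝ => (r : ℂ)) := by
  have hdet : (huaCoeff z).det = -Complex.I * ((quad z + 1) * (conj (quad z) - 1)
      + (quad z - 1) * (conj (quad z) + 1)) := by
    rw [huaCoeff, Matrix.det_fin_two_of]; ring
  have hI : conj Complex.I = -Complex.I := Complex.conj_I
  have hd : conj (huaCoeff z).det = -(huaCoeff z).det := by
    rw [hdet]; simp only [map_mul, map_add, map_sub, map_one, map_neg, hI, Complex.conj_conj]; ring
  have hdi : conj (Ring.inverse (huaCoeff z).det) = -Ring.inverse (huaCoeff z).det := by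
    rw [Ring.inverse_eq_inv', map_inv₀, hd, inv_neg]
  have key : ∀ i j, conj (huaComplex z i j) = huaComplex z i j := by
    intro i j
    fin_cases j <;>
    · have h2 : conj (2 : ℂ) = 2 := map_ofNat _ 2
      simp only [huaComplex, h2, Matrix.inv_def, Matrix.smul_apply, Matrix.transpose_apply,
        Matrix.mul_apply, Fin.sum_univ_two, smul_eq_mul, map_mul, map_add, hdi]
      simp [huaCoeff, huaRows, Matrix.adjugate_fin_two_of, hI]
      ring
  ext i j
  simp only [hua, Matrix.map_apply]
  exact (Complex.conj_eq_iff_re.mp (key i j)).symm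

end LieBall

end

namespace LieBall

/-! ### Elementary facts about the quadratic form and the Lie ball -/

/-! Write a real matrix `Z` with columns `X`, `Y` as the complex vector `ζ = X - iY`, and put `q = z
zᵗ`. The Hua transform becomes the solution of `ζ + q ζ̄ = 2z`. With `s = ζ ζᵗ` and `a = |ζ|²`,
squaring this equation and eliminating conjugates gives `s (1 + |q|²) = q (4 - 2a)`, while `M` is
the set `a + |s| < 2`. So `q` has the phase of `s`, and `|q|` is the unique root in `[0, 1)` of a
real quadratic; this gives the bijection.

For the groups, the same equation reads `z = X (1+q)/2 - Y i(1-q)/2`. The vector `((1+q)/2, z)` has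
Lorentz square `((1-q)/2)²`, so adjoining `(1-q)/2` as an extra coordinate gives a null vector. A
matrix of `SO₀(1,n)` acts on the first `1 + n` coordinates and leaves the extra one alone; rescaling
back to the normal form defines `act` on the Lie ball. Comparing real coefficients shows that `hua`
carries `act` to the fractional linear action through `θ` (`hua_act`).

Conversely, let an automorphism preserve the real part. A Lorentz involution moves the image of `0`
back to `0`. The Schwarz lemma, applied to the map and its inverse on the discs through real unit
vectors, shows that the derivative at `0` is isometric on real vectors; the equality case and the
identity principle make the map linear, given by a real orthogonal matrix. Hence every such
automorphism is some `act g` (`exists_act_of_preserves_realPart`). The matrix `g` depends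
continuously on finitely many values of the automorphism (`recover`), so connectedness identifies
`H` with `SO₀(1,n)` algebraically and topologically.

Inside `SO₀(2,n)`, preserving the matrices `(X 0)` forces the second basis vector to be mapped to
plus or minus itself. On the identity component the sign is plus, and orthogonality then leaves
exactly the image of `θ`. -/

theorem norm_quad_le {n : ℕ} (z : EuclideanSpace ℂ (Fin n)) : ‖quad z‖ ≤ ‖z‖ ^ 2 := by
  rw [EuclideanSpace.norm_sq_eq, quad]
  refine (norm_sum_le _ _).trans (le_of_eq ?_)
  simp

theorem ofReal_norm_sq {n : ℕ} (z : EuclideanSpace ℂ (Fin n)) :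
    ((‖z‖ ^ 2 : ℝ) : ℂ) = ∑ i, z i * conj (z i) := by
  rw [EuclideanSpace.norm_sq_eq, Complex.ofReal_sum]
  refine Finset.sum_congr rfl fun i _ => ?_
  rw [Complex.mul_conj, Complex.normSq_eq_norm_sq]

/-- The condition `|z| < 1` only selects a component of the first inequality, and `|q| < 1` selects
the same one: `|q| ≤ |z|²` in one direction, `2|z|² < 1 + |q|²` in the other. This second form
drives all later estimates. -/
theorem mem_lieBall_iff {n : ℕ} {z : EuclideanSpace ℂ (Fin n)} :
    z ∈ lieBall n ↔ 0 < 1 - 2 * ‖z‖ ^ 2 + ‖quad z‖ ^ 2 ∧ ‖quad z‖ < 1 := by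
  have h := norm_quad_le z
  have h0 := norm_nonneg z
  have h1 := norm_nonneg (quad z)
  constructor
  · rintro ⟨h2, h3⟩
    exact ⟨h2, by nlinarith⟩
  · rintro ⟨h2, h3⟩
    refine ⟨h2, ?_⟩
    nlinarith

theorem norm_quad_lt_one {n : ℕ} {z : EuclideanSpace ℂ (Fin n)} (hz : z ∈ lieBall n) :
    ‖quad z‖ < 1 := (mem_lieBall_iff.1 hz).2

theorem one_sub_quad_ne_zero {n : ℕ} {z : EuclideanSpace ℂ (Fin n)} (hz : z ∈ lieBall n) :
    1 - quad z ≠ 0 := by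
  intro h
  have h1 := norm_quad_lt_one hz
  rw [← sub_eq_zero.1 h] at h1
  simp at h1

theorem quad_ofRealVec {n : ℕ} (x : EuclideanSpace ℝ (Fin n)) :
    quad (ofRealVec x) = ((‖x‖ ^ 2 : ℝ) : ℂ) := by
  rw [EuclideanSpace.norm_sq_eq]
  simp [quad, ofRealVec]

theorem norm_ofRealVec {n : ℕ} (x : EuclideanSpace ℝ (Fin n)) : ‖ofRealVec x‖ = ‖x‖ := by
  simp [EuclideanSpace.norm_eq, ofRealVec]

theorem ofRealVec_mem_lieBall_iff {n : ℕ} {x : EuclideanSpace ℝ (Fin n)} :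
    ofRealVec x ∈ lieBall n ↔ ‖x‖ < 1 := by
  rw [lieBall, Set.mem_ofPred_eq, norm_ofRealVec, quad_ofRealVec, Complex.norm_real,
    Real.norm_of_nonneg (by positivity)]
  refine ⟨fun h => h.2, fun h => ⟨?_, h⟩⟩
  have h1 : 0 < 1 - ‖x‖ ^ 2 := by nlinarith [norm_nonneg x]
  nlinarith [mul_pos h1 h1]

/-! ### The complex vector attached to a real `n × 2` matrix -/

/-- The vector `X - iY` attached to the real matrix with columns `X` and `Y`. -/
noncomputable def zeta {n : ℕ} (Z : Matrix (Fin n) (Fin 2) ℝ) : EuclideanSpace ℂ (Fin n) :=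
  WithLp.toLp 2 fun j => (Z j 0 : ℂ) - Complex.I * (Z j 1 : ℂ)

theorem zeta_apply {n : ℕ} (Z : Matrix (Fin n) (Fin 2) ℝ) (j : Fin n) :
    zeta Z j = (Z j 0 : ℂ) - Complex.I * (Z j 1 : ℂ) := rfl

theorem conj_zeta_apply {n : ℕ} (Z : Matrix (Fin n) (Fin 2) ℝ) (j : Fin n) :
    conj (zeta Z j) = (Z j 0 : ℂ) + Complex.I * (Z j 1 : ℂ) := by
  simp [zeta_apply]

theorem zeta_injective {n : ℕ} : Function.Injective (zeta (n := n)) := by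
  intro Z W h
  have h1 : ∀ j, zeta Z j = zeta W j := fun j => by rw [h]
  ext i j
  have h2 := congrArg Complex.re (h1 i)
  have h3 := congrArg Complex.im (h1 i)
  simp [zeta_apply] at h2 h3
  fin_cases j
  · exact h2
  · exact h3

theorem norm_zeta_sq {n : ℕ} (Z : Matrix (Fin n) (Fin 2) ℝ) :
    ‖zeta Z‖ ^ 2 = ∑ j, Z j 0 ^ 2 + ∑ j, Z j 1 ^ 2 := by
  rw [EuclideanSpace.norm_sq_eq, ← Finset.sum_add_distrib]
  refine Finset.sum_congr rfl fun j _ => ?_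
  rw [← Complex.normSq_eq_norm_sq, zeta_apply]
  simp [Complex.normSq_apply]
  ring

theorem norm_quad_zeta_sq {n : ℕ} (Z : Matrix (Fin n) (Fin 2) ℝ) :
    ‖quad (zeta Z)‖ ^ 2 =
      (∑ j, Z j 0 ^ 2 - ∑ j, Z j 1 ^ 2) ^ 2 + 4 * (∑ j, Z j 0 * Z j 1) ^ 2 := by
  have h : quad (zeta Z) = ((∑ j, Z j 0 ^ 2 - ∑ j, Z j 1 ^ 2 : ℝ) : ℂ) +
      ((-2 * ∑ j, Z j 0 * Z j 1 : ℝ) : ℂ) * Complex.I := by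
    simp only [quad, zeta_apply]
    push_cast
    rw [← Finset.sum_sub_distrib, Finset.mul_sum, Finset.sum_mul, ← Finset.sum_add_distrib]
    refine Finset.sum_congr rfl fun j _ => ?_
    linear_combination ((Z j 1 : ℂ)) ^ 2 * Complex.I_sq
  rw [h, ← Complex.normSq_eq_norm_sq, Complex.normSq_add_mul_I]
  ring

/-! ### The matrix ball -/

theorem mem_matBall_iff_entries {n : ℕ} {Z : Matrix (Fin n) (Fin 2) ℝ} :
    Z ∈ matBall n ↔ ∑ j, Z j 0 ^ 2 < 1 ∧
      (∑ j, Z j 0 * Z j 1) ^ 2 < (1 - ∑ j, Z j 0 ^ 2) * (1 - ∑ j, Z j 1 ^ 2) := by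
  have e00 : (1 - Zᵀ * Z : Matrix (Fin 2) (Fin 2) ℝ) 0 0 = 1 - ∑ j, Z j 0 ^ 2 := by
    simp [Matrix.mul_apply, sq]
  have e11 : (1 - Zᵀ * Z : Matrix (Fin 2) (Fin 2) ℝ) 1 1 = 1 - ∑ j, Z j 1 ^ 2 := by
    simp [Matrix.mul_apply, sq]
  have e01 : (1 - Zᵀ * Z : Matrix (Fin 2) (Fin 2) ℝ) 0 1 = - ∑ j, Z j 0 * Z j 1 := by
    simp [Matrix.mul_apply]
  have e10 : (1 - Zᵀ * Z : Matrix (Fin 2) (Fin 2) ℝ) 1 0 = - ∑ j, Z j 0 * Z j 1 := by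
    simp [Matrix.mul_apply, mul_comm]
  constructor
  · intro h
    have h0 := h.diag_pos (i := 0)
    have h1 := h.det_pos
    rw [Matrix.det_fin_two, e00, e11, e01, e10] at h1
    rw [e00] at h0
    exact ⟨by linarith, by nlinarith⟩
  · rintro ⟨h0, h1⟩
    refine Matrix.PosDef.of_dotProduct_mulVec_pos ?_ ?_
    · ext i j
      fin_cases i <;> fin_cases j <;> simp [Matrix.mul_apply, mul_comm]
    · intro x hx
      simp only [dotProduct, Matrix.mulVec, Fin.sum_univ_two, e00, e11, e01, e10, Pi.star_apply,
        star_trivial]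
      set p := 1 - ∑ j, Z j 0 ^ 2
      set s := 1 - ∑ j, Z j 1 ^ 2
      set r := ∑ j, Z j 0 * Z j 1
      have hp : 0 < p := by simp only [p]; linarith
      -- Completing the square after multiplying the quadratic form by `p > 0`.
      have key : p * (x 0 * (p * x 0 + -r * x 1) + x 1 * (-r * x 0 + s * x 1)) =
          (p * x 0 - r * x 1) ^ 2 + (p * s - r ^ 2) * x 1 ^ 2 := by ring
      have hd : 0 < p * s - r ^ 2 := by linarith
      refine pos_of_mul_pos_right (a := p) ?_ hp.le
      rw [key]
      by_cases hx1 : x 1 = 0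
      · have hx0 : x 0 ≠ 0 := by
          intro h
          apply hx
          ext i
          fin_cases i
          · exact h
          · exact hx1
        simp only [hx1]
        have := mul_pos (mul_pos hp hp) (sq_pos_of_ne_zero hx0)
        nlinarith
      · have := mul_pos hd (sq_pos_of_ne_zero hx1)
        nlinarith [sq_nonneg (p * x 0 - r * x 1)]

/-- The eigenvalues of `ZᵗZ` are `(|ζ|² ± |ζ ζᵗ|)/2`, since `|ζ ζᵗ|²` is the discriminant of its
characteristic polynomial; the condition says that the larger one is below `1`. -/
theorem mem_matBall_iff {n : ℕ} {Z : Matrix (Fin n) (Fin 2) ℝ} :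
    Z ∈ matBall n ↔ ‖zeta Z‖ ^ 2 + ‖quad (zeta Z)‖ < 2 := by
  rw [mem_matBall_iff_entries]
  have h1 := norm_zeta_sq Z
  have h2 := norm_quad_zeta_sq Z
  have h3 := norm_nonneg (quad (zeta Z))
  set a := ∑ j, Z j 0 ^ 2
  set b := ∑ j, Z j 1 ^ 2
  set r := ∑ j, Z j 0 * Z j 1
  rw [h1]
  constructor
  · rintro ⟨ha, hr⟩
    have hb : b < 1 := by
      have : 0 < (1 - a) * (1 - b) := lt_of_le_of_lt (sq_nonneg _) hr
      have := pos_of_mul_pos_right this (by linarith)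
      linarith
    have : ‖quad (zeta Z)‖ < 2 - a - b := by
      refine lt_of_pow_lt_pow_left₀ 2 (by linarith) ?_
      rw [h2]
      nlinarith
    linarith
  · intro h
    have h4 : ‖quad (zeta Z)‖ ^ 2 < (2 - a - b) ^ 2 :=
      pow_lt_pow_left₀ (by linarith) h3 (by norm_num)
    rw [h2] at h4
    refine ⟨?_, by nlinarith⟩
    have : |a - b| < 2 - a - b := by
      refine abs_lt_of_sq_lt_sq ?_ (by linarith)
      nlinarith [sq_nonneg r]
    have := le_abs_self (a - b)
    linarith

/-! ### The Hua transform as a solution of `ζ + q ζ̄ = 2 z` -/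

theorem hua_linear {n : ℕ} {z : EuclideanSpace ℂ (Fin n)} (hq : ‖quad z‖ < 1) (j : Fin n) :
    (quad z + 1) * (hua z j 0 : ℂ) + Complex.I * (quad z - 1) * (hua z j 1 : ℂ) = 2 * z j := by
  have hdet : (huaCoeff z).det = 2 * Complex.I * ((1 - ‖quad z‖ ^ 2 : ℝ) : ℂ) := by
    rw [huaCoeff, Matrix.det_fin_two_of]
    push_cast
    rw [← Complex.mul_conj']
    ring
  have hu : IsUnit (huaCoeff z).det := by
    rw [hdet, isUnit_iff_ne_zero]
    have : (1 - ‖quad z‖ ^ 2 : ℝ) ≠ 0 := by nlinarith [norm_nonneg (quad z)]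
    exact mul_ne_zero (by simp) (Complex.ofReal_ne_zero.2 this)
  have h1 : huaCoeff z * (huaComplex z)ᵀ = (2 : ℂ) • huaRows z := by
    rw [huaComplex, Matrix.transpose_smul, Matrix.transpose_transpose, Matrix.mul_smul,
      Matrix.mul_nonsing_inv_cancel_left _ _ hu]
  have h2 := congrFun (congrFun h1 0) j
  rw [huaComplex_eq_hua] at h2
  simpa [Matrix.mul_apply, huaCoeff, huaRows] using h2

theorem zeta_hua {n : ℕ} {z : EuclideanSpace ℂ (Fin n)} (hq : ‖quad z‖ < 1) (j : Fin n) :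
    zeta (hua z) j + quad z * conj (zeta (hua z) j) = 2 * z j := by
  rw [← hua_linear hq j, conj_zeta_apply, zeta_apply]
  ring

/-- The real-linear map `ζ ↦ ζ + q ζ̄` is injective for `|q| < 1`: a difference `d` of two solutions
has `|d| = |q| |d|`. -/
theorem eq_hua_of_zeta {n : ℕ} {z : EuclideanSpace ℂ (Fin n)} (hq : ‖quad z‖ < 1)
    {Z : Matrix (Fin n) (Fin 2) ℝ}
    (h : ∀ j, zeta Z j + quad z * conj (zeta Z j) = 2 * z j) : hua z = Z := by
  apply zeta_injective
  ext j
  have h1 := zeta_hua hq j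
  have h2 : (zeta (hua z) j - zeta Z j) = - quad z * conj (zeta (hua z) j - zeta Z j) := by
    rw [map_sub]
    linear_combination h1 - h j
  have h3 := congrArg norm h2
  rw [norm_mul, norm_neg, Complex.norm_conj] at h3
  have h4 : ‖zeta (hua z) j - zeta Z j‖ = 0 := by
    nlinarith [norm_nonneg (zeta (hua z) j - zeta Z j)]
  exact sub_eq_zero.1 (norm_eq_zero.1 h4)

/-- Here `q` is a free parameter: the surjectivity proof applies this before `quad z = q` is known,
precisely in order to obtain it. -/
theorem four_quad {n : ℕ} {z w : EuclideanSpace ℂ (Fin n)} {q : ℂ}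
    (h : ∀ j, w j + q * conj (w j) = 2 * z j) :
    4 * quad z = quad w + 2 * q * ((‖w‖ ^ 2 : ℝ) : ℂ) + q ^ 2 * conj (quad w) := by
  rw [ofReal_norm_sq]
  simp only [quad, map_sum, map_pow, Finset.mul_sum]
  rw [← Finset.sum_add_distrib, ← Finset.sum_add_distrib]
  refine Finset.sum_congr rfl fun j _ => ?_
  linear_combination -(2 * z j + (w j + q * conj (w j))) * h j

theorem four_norm_sq {n : ℕ} {z w : EuclideanSpace ℂ (Fin n)} {q : ℂ}
    (h : ∀ j, w j + q * conj (w j) = 2 * z j) :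
    4 * ‖z‖ ^ 2 = ‖w‖ ^ 2 * (1 + ‖q‖ ^ 2) + 2 * (quad w * conj q).re := by
  have key : ((4 * ‖z‖ ^ 2 : ℝ) : ℂ) = ((‖w‖ ^ 2 : ℝ) : ℂ) * (1 + q * conj q) +
      (quad w * conj q + conj (quad w * conj q)) := by
    rw [Complex.ofReal_mul, ofReal_norm_sq, ofReal_norm_sq]
    simp only [quad, map_mul, map_sum, map_pow, Complex.conj_conj, Finset.mul_sum, Finset.sum_mul]
    rw [← Finset.sum_add_distrib, ← Finset.sum_add_distrib]
    refine Finset.sum_congr rfl fun j _ => ?_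
    have h1 := congrArg conj (h j)
    simp only [map_add, map_mul, Complex.conj_conj, map_ofNat] at h1
    push_cast
    linear_combination -(2 * conj (z j)) * h j - (w j + q * conj (w j)) * h1
  rw [Complex.mul_conj', Complex.add_conj] at key
  exact_mod_cast key

/-- Subtracting `q²` times the conjugate equation removes `conj s`; a factor `1 - |q|² ≠ 0` then
cancels. -/
theorem quad_scale {q s : ℂ} {a : ℝ} (hq : ‖q‖ < 1)
    (h : 4 * q = s + 2 * q * (a : ℂ) + q ^ 2 * conj s) :
    s * (1 + ‖q‖ ^ 2 : ℝ) = q * (4 - 2 * a : ℝ) := by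
  have h1 := congrArg conj h
  simp only [map_add, map_mul, map_pow, Complex.conj_conj, map_ofNat, Complex.conj_ofReal] at h1
  have ht : ((1 - ‖q‖ ^ 2 : ℝ) : ℂ) ≠ 0 := by
    refine Complex.ofReal_ne_zero.2 ?_
    nlinarith [norm_nonneg q]
  apply mul_right_cancel₀ ht
  push_cast at *
  rw [← Complex.mul_conj']
  linear_combination q ^ 2 * h1 - h

theorem hua_mem_matBall {n : ℕ} {z : EuclideanSpace ℂ (Fin n)} (hz : z ∈ lieBall n) :
    hua z ∈ matBall n := by
  obtain ⟨h1, hq⟩ := mem_lieBall_iff.1 hz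
  rw [mem_matBall_iff]
  have h2 := quad_scale hq (four_quad (zeta_hua hq))
  have h3 := four_norm_sq (zeta_hua hq)
  set q := quad z
  set s := quad (zeta (hua z))
  set a := ‖zeta (hua z)‖ ^ 2
  set t := ‖q‖
  have ht : 0 ≤ t := norm_nonneg q
  have h4 : (s * conj q).re * (1 + t ^ 2) = (4 - 2 * a) * t ^ 2 := by
    have : s * conj q * ((1 + t ^ 2 : ℝ) : ℂ) = (((4 - 2 * a) * t ^ 2 : ℝ) : ℂ) := by
      rw [mul_right_comm, h2]
      push_cast
      rw [← Complex.mul_conj']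
      ring
    have := congrArg Complex.re this
    rwa [Complex.re_mul_ofReal, Complex.ofReal_re] at this
  -- The two sides of the argument meet in the identity `4 (1 - 2|z|² + t²)(1 + t²) = (4 - 2a)(1 -
  -- t²)²`.
  have h5 : 0 < (4 - 2 * a) * (1 - t ^ 2) ^ 2 := by
    have : 0 < (4 * (1 - 2 * ‖z‖ ^ 2 + t ^ 2)) * (1 + t ^ 2) := by positivity
    nlinarith
  have h6 : 0 < 4 - 2 * a := pos_of_mul_pos_left h5 (by positivity)
  have h7 := congrArg norm h2
  rw [norm_mul, norm_mul, Complex.norm_real, Complex.norm_real, Real.norm_of_nonneg h6.le,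
    Real.norm_of_nonneg (by positivity)] at h7
  have h8 : 0 < (2 - a) * (1 - t) ^ 2 :=
    mul_pos (by linarith) (pow_pos (by linarith) 2)
  have h9 : ‖s‖ * (1 + t ^ 2) < (2 - a) * (1 + t ^ 2) := by
    rw [h7]
    change t * _ < _
    nlinarith
  have := lt_of_mul_lt_mul_right h9 (by positivity)
  linarith

/-- The modulus `|q|` is recovered from `ζ` because `t/(1 + t²)` is injective on `[0, 1)`; then `q`,
and finally `z = (ζ + q ζ̄)/2`, follow. -/
theorem hua_injOn {n : ℕ} : Set.InjOn (hua (n := n)) (lieBall n) := by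
  intro z hz w hw h
  have hq := norm_quad_lt_one hz
  have hq' := norm_quad_lt_one hw
  have h1 := zeta_hua hq
  have h2 := zeta_hua hq'
  have hM := mem_matBall_iff.1 (hua_mem_matBall hz)
  rw [← h] at h2
  have h3 := quad_scale hq (four_quad h1)
  have h4 := quad_scale hq' (four_quad h2)
  set s := quad (zeta (hua z))
  set a := ‖zeta (hua z)‖ ^ 2
  have h6 : 0 < 4 - 2 * a := by linarith [norm_nonneg s]
  have h7 := congrArg norm h3
  have h8 := congrArg norm h4
  rw [norm_mul, norm_mul, Complex.norm_real, Complex.norm_real, Real.norm_of_nonneg h6.le,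
    Real.norm_of_nonneg (by positivity)] at h7 h8
  have h9 : ‖quad z‖ = ‖quad w‖ := by
    have e : (4 - 2 * a) * ((‖quad z‖ - ‖quad w‖) * (1 - ‖quad z‖ * ‖quad w‖)) = 0 := by
      linear_combination (1 + ‖quad z‖ ^ 2) * h8 - (1 + ‖quad w‖ ^ 2) * h7
    have e1 : 0 < 1 - ‖quad z‖ * ‖quad w‖ := by
      nlinarith [norm_nonneg (quad z), norm_nonneg (quad w)]
    have e2 := (mul_eq_zero.1 e).resolve_left h6.ne'
    exact sub_eq_zero.1 ((mul_eq_zero.1 e2).resolve_right e1.ne')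
  have h10 : quad z = quad w := by
    rw [h9, h4] at h3
    exact (mul_right_cancel₀ (Complex.ofReal_ne_zero.2 h6.ne') h3).symm
  ext j
  have := h1 j
  rw [h10, h2 j] at this
  exact (mul_left_cancel₀ two_ne_zero this).symm

theorem exists_hua_eq {n : ℕ} {Z : Matrix (Fin n) (Fin 2) ℝ} (hZ : Z ∈ matBall n) :
    ∃ z ∈ lieBall n, hua z = Z := by
  rw [mem_matBall_iff] at hZ
  set s := quad (zeta Z) with hs
  set a := ‖zeta Z‖ ^ 2 with ha
  have hs0 := norm_nonneg s
  set S := Real.sqrt ((2 - a) ^ 2 - ‖s‖ ^ 2) with hS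
  have hS2 : S ^ 2 = (2 - a) ^ 2 - ‖s‖ ^ 2 := Real.sq_sqrt (by nlinarith)
  have hS0 : 0 ≤ S := Real.sqrt_nonneg _
  -- The larger root of `κ² - 2(2 - a)κ + |s|² = 0`, the equation that `quad_scale` imposes on `κ =
  -- s/q`. Unlike `s`, it never vanishes, so `q = s/κ` needs no case distinction, and the larger
  -- root gives `|q| < 1`.
  set κ := (2 - a) + S with hκ
  have hκ0 : 0 < κ := by linarith
  have hκ' : (κ : ℂ) ≠ 0 := Complex.ofReal_ne_zero.2 hκ0.ne'
  have hκ2 : κ ^ 2 - 2 * (2 - a) * κ + ‖s‖ ^ 2 = 0 := by rw [hκ]; nlinarith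
  set q : ℂ := s / κ with hq
  have hqs : s = q * κ := by rw [hq]; field_simp
  have hns : ‖s‖ = ‖q‖ * κ := by
    rw [hqs, norm_mul, Complex.norm_real, Real.norm_of_nonneg hκ0.le]
  have hq1 : ‖q‖ < 1 := by
    by_contra hcon
    nlinarith
  have e1 : κ * (1 + ‖q‖ ^ 2) = 4 - 2 * a := by
    have : κ * (κ * (1 + ‖q‖ ^ 2)) = κ * (4 - 2 * a) := by
      rw [hns] at hκ2
      nlinarith
    exact mul_left_cancel₀ hκ0.ne' this
  set z : EuclideanSpace ℂ (Fin n) :=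
    WithLp.toLp 2 fun j => (zeta Z j + q * conj (zeta Z j)) / 2 with hz
  have hrel : ∀ j, zeta Z j + q * conj (zeta Z j) = 2 * z j := by
    intro j
    simp only [hz]
    ring
  have hquad : quad z = q := by
    have h4 := four_quad hrel
    rw [← hs, ← ha] at h4
    have e2 : (κ : ℂ) * (1 + q * conj q) = 4 - 2 * a := by
      rw [Complex.mul_conj']
      exact_mod_cast e1
    have e3 : conj s = conj q * κ := by rw [hqs, map_mul, Complex.conj_ofReal]
    have e4 : 4 * quad z = 4 * q := by
      rw [h4, e3]
      linear_combination hqs + q * e2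
    exact mul_left_cancel₀ (by norm_num : (4 : ℂ) ≠ 0) e4
  refine ⟨z, mem_lieBall_iff.2 ?_, ?_⟩
  · rw [hquad]
    refine ⟨?_, hq1⟩
    have h5 := four_norm_sq hrel
    rw [← hs, ← ha] at h5
    have e5 : (s * conj q).re = κ * ‖q‖ ^ 2 := by
      have : s * conj q = ((κ * ‖q‖ ^ 2 : ℝ) : ℂ) := by
        rw [hqs]
        push_cast
        rw [← Complex.mul_conj']
        ring
      rw [this, Complex.ofReal_re]
    rw [e5] at h5
    have e6 : 0 < κ * (1 - ‖q‖ ^ 2) ^ 2 :=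
      mul_pos hκ0 (pow_pos (by nlinarith [norm_nonneg q]) 2)
    nlinarith
  · refine eq_hua_of_zeta (by rwa [hquad]) ?_
    rw [hquad]
    exact hrel

theorem hua_bijOn (n : ℕ) : Set.BijOn (hua (n := n)) (lieBall n) (matBall n) :=
  ⟨fun _ hz => hua_mem_matBall hz, hua_injOn, fun _ hZ => exists_hua_eq hZ⟩

/-! ### The Hua transform on the real part -/

theorem hua_ofRealVec {n : ℕ} {x : EuclideanSpace ℝ (Fin n)} (hx : ‖x‖ < 1) :
    hua (ofRealVec x) = colZero ((2 / (1 + ‖x‖ ^ 2)) • x) := by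
  have hq := norm_quad_lt_one (ofRealVec_mem_lieBall_iff.2 hx)
  refine eq_hua_of_zeta hq fun j => ?_
  have h : ((1 + ‖x‖ ^ 2 : ℝ) : ℂ) ≠ 0 := Complex.ofReal_ne_zero.2 (by positivity)
  rw [quad_ofRealVec, conj_zeta_apply, zeta_apply]
  simp only [colZero, ofRealVec, Matrix.of_apply, Matrix.cons_val_zero, Matrix.cons_val_one,
    PiLp.smul_apply, smul_eq_mul]
  push_cast at h ⊢
  field_simp
  ring

/-- The diffeomorphism `x ↦ 2x / (1 + |x|²)` of the unit ball, with inverse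
`X ↦ X / (1 + √(1 - |X|²))`. -/
noncomputable def ballDiffeo (n : ℕ) :
    OpenPartialHomeomorph (EuclideanSpace ℝ (Fin n)) (EuclideanSpace ℝ (Fin n)) where
  toFun x := (2 / (1 + ‖x‖ ^ 2)) • x
  invFun X := (1 / (1 + Real.sqrt (1 - ‖X‖ ^ 2))) • X
  source := {x | ‖x‖ < 1}
  target := {X | ‖X‖ < 1}
  map_source' := by
    intro x hx
    have hx : ‖x‖ < 1 := hx
    change ‖_‖ < 1
    rw [norm_smul, Real.norm_of_nonneg (by positivity), div_mul_eq_mul_div,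
      div_lt_one (by positivity)]
    nlinarith [mul_pos (sub_pos.2 hx) (sub_pos.2 hx)]
  map_target' := by
    intro X hX
    have hX : ‖X‖ < 1 := hX
    change ‖_‖ < 1
    have := Real.sqrt_nonneg (1 - ‖X‖ ^ 2)
    rw [norm_smul, Real.norm_of_nonneg (by positivity), one_div_mul_eq_div,
      div_lt_one (by positivity)]
    linarith
  left_inv' := by
    intro x hx
    have hx : ‖x‖ < 1 := hx
    have h1 : (0 : ℝ) < 1 + ‖x‖ ^ 2 := by positivity
    have h2 : 1 - ‖(2 / (1 + ‖x‖ ^ 2)) • x‖ ^ 2 = ((1 - ‖x‖ ^ 2) / (1 + ‖x‖ ^ 2)) ^ 2 := by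
      rw [norm_smul, Real.norm_of_nonneg (by positivity)]
      field_simp
      ring
    have h3 : 0 ≤ (1 - ‖x‖ ^ 2) / (1 + ‖x‖ ^ 2) := by
      apply div_nonneg _ h1.le
      nlinarith [norm_nonneg x]
    simp only [h2, Real.sqrt_sq h3, smul_smul]
    convert one_smul ℝ x using 2
    field_simp
    ring
  right_inv' := by
    intro X hX
    have hX : ‖X‖ < 1 := hX
    have h0 := Real.sqrt_nonneg (1 - ‖X‖ ^ 2)
    have h1 : Real.sqrt (1 - ‖X‖ ^ 2) ^ 2 = 1 - ‖X‖ ^ 2 :=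
      Real.sq_sqrt (by nlinarith [norm_nonneg X])
    simp only [norm_smul, smul_smul]
    rw [Real.norm_of_nonneg (by positivity)]
    convert one_smul ℝ X using 2
    set S := Real.sqrt (1 - ‖X‖ ^ 2)
    have h2 : ‖X‖ ^ 2 = 1 - S ^ 2 := by linarith
    have h3 : 0 < 1 + S := by positivity
    have h4 : 1 + (1 / (1 + S) * ‖X‖) ^ 2 = 2 / (1 + S) := by
      rw [mul_pow, h2]
      field_simp
      ring
    rw [h4]
    field_simp
  open_source := isOpen_lt continuous_norm continuous_const
  open_target := isOpen_lt continuous_norm continuous_const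
  continuousOn_toFun := by
    refine Continuous.continuousOn (Continuous.smul (f := fun x : EuclideanSpace ℝ (Fin n) =>
      2 / (1 + ‖x‖ ^ 2)) (Continuous.div (by fun_prop) (by fun_prop) fun x => ?_) continuous_id)
    positivity
  continuousOn_invFun := by
    refine Continuous.continuousOn (Continuous.smul (f := fun x : EuclideanSpace ℝ (Fin n) =>
      1 / (1 + Real.sqrt (1 - ‖x‖ ^ 2))) (Continuous.div (by fun_prop) (by fun_prop)
      fun x => ?_) continuous_id)
    have := Real.sqrt_nonneg (1 - ‖x‖ ^ 2)
    positivity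

theorem contDiffOn_ballDiffeo (n : ℕ) :
    ContDiffOn ℝ ∞ (ballDiffeo n) (ballDiffeo n).source := by
  refine ContDiffOn.smul (f := fun x : EuclideanSpace ℝ (Fin n) => 2 / (1 + ‖x‖ ^ 2))
    (ContDiffOn.div contDiffOn_const (contDiffOn_const.add (contDiff_norm_sq ℝ).contDiffOn)
    fun x _ => ?_) contDiffOn_id
  positivity

theorem contDiffOn_ballDiffeo_symm (n : ℕ) :
    ContDiffOn ℝ ∞ (ballDiffeo n).symm (ballDiffeo n).target := by
  refine ContDiffOn.smul
    (f := fun x : EuclideanSpace ℝ (Fin n) => 1 / (1 + Real.sqrt (1 - ‖x‖ ^ 2)))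
    (ContDiffOn.div contDiffOn_const (contDiffOn_const.add (ContDiffOn.sqrt
      (contDiffOn_const.sub (contDiff_norm_sq ℝ).contDiffOn) fun x hx => ?_))
    fun x _ => ?_) contDiffOn_id
  · have hx : ‖x‖ < 1 := hx
    nlinarith [norm_nonneg x]
  · have := Real.sqrt_nonneg (1 - ‖x‖ ^ 2)
    positivity

theorem hua_image_realPart (n : ℕ) :
    hua '' realPart n = {Z | ∃ X : EuclideanSpace ℝ (Fin n), ‖X‖ < 1 ∧ Z = colZero X} := by
  ext Z
  constructor
  · rintro ⟨_, ⟨hx, x, rfl⟩, rfl⟩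
    have hx := ofRealVec_mem_lieBall_iff.1 hx
    exact ⟨_, (ballDiffeo n).map_source hx, hua_ofRealVec hx⟩
  · rintro ⟨X, hX, rfl⟩
    have hx : ‖(ballDiffeo n).symm X‖ < 1 := (ballDiffeo n).map_target hX
    refine ⟨ofRealVec ((ballDiffeo n).symm X), ⟨ofRealVec_mem_lieBall_iff.2 hx, _, rfl⟩, ?_⟩
    rw [hua_ofRealVec hx]
    exact congrArg colZero ((ballDiffeo n).right_inv hX)

/-! ### Lorentz matrices -/

/-- The Gram matrix of the form of signature `(1,n)`. -/
def lorentz (R : Type*) [CommRing R] (n : ℕ) : Matrix (Fin 1 ⊕ Fin n) (Fin 1 ⊕ Fin n) R :=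
  Matrix.diagonal (Sum.elim (fun _ => 1) fun _ => -1)

theorem dotProduct_lorentz_mulVec {R : Type*} [CommRing R] {n : ℕ} (x y : Fin 1 ⊕ Fin n → R) :
    x ⬝ᵥ (lorentz R n *ᵥ y) =
      x (Sum.inl 0) * y (Sum.inl 0) - ∑ j, x (Sum.inr j) * y (Sum.inr j) := by
  simp [lorentz, dotProduct, Matrix.mulVec_diagonal, sub_eq_add_neg]

theorem form_eq_dotProduct {n : ℕ} (x y : Fin 1 ⊕ Fin n → ℝ) :
    form 1 n x y = x ⬝ᵥ (lorentz ℝ n *ᵥ y) := by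
  simp [dotProduct_lorentz_mulVec, form]

theorem lorentz_mul_lorentz (R : Type*) [CommRing R] (n : ℕ) :
    lorentz R n * lorentz R n = 1 := by
  rw [lorentz, Matrix.diagonal_mul_diagonal, ← Matrix.diagonal_one]
  congr 1
  ext i
  rcases i with i | i <;> simp

theorem dotProduct_lorentz_mulVec_mulVec {R : Type*} [CommRing R] {n : ℕ}
    {g : Matrix (Fin 1 ⊕ Fin n) (Fin 1 ⊕ Fin n) R} (hg : gᵀ * lorentz R n * g = lorentz R n)
    (x y : Fin 1 ⊕ Fin n → R) :
    (g *ᵥ x) ⬝ᵥ (lorentz R n *ᵥ (g *ᵥ y)) = x ⬝ᵥ (lorentz R n *ᵥ y) := by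
  conv_rhs => rw [← hg]
  rw [← Matrix.mulVec_mulVec, ← Matrix.mulVec_mulVec, Matrix.dotProduct_mulVec x gᵀ,
    Matrix.vecMul_transpose]

theorem preserves_form_iff {n : ℕ} {g : Matrix (Fin 1 ⊕ Fin n) (Fin 1 ⊕ Fin n) ℝ} :
    (∀ x y, form 1 n (g *ᵥ x) (g *ᵥ y) = form 1 n x y) ↔
      gᵀ * lorentz ℝ n * g = lorentz ℝ n := by
  simp only [form_eq_dotProduct]
  refine ⟨fun h => ?_, fun h => dotProduct_lorentz_mulVec_mulVec h⟩
  ext i j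
  have := h (Pi.single i 1) (Pi.single j 1)
  rw [← Matrix.vecMul_transpose, ← Matrix.dotProduct_mulVec, Matrix.mulVec_mulVec,
    Matrix.mulVec_mulVec] at this
  simpa using this

/-- A real matrix preserving the form of signature `(1,n)` and the future light cone. -/
structure IsOrthochronous {n : ℕ} (g : Matrix (Fin 1 ⊕ Fin n) (Fin 1 ⊕ Fin n) ℝ) : Prop where
  preserves : ∀ x y, form 1 n (g *ᵥ x) (g *ᵥ y) = form 1 n x y
  pos : 0 < g (Sum.inl 0) (Sum.inl 0)

/-- The left inverse `J gᵗ J` of `g` is also a right inverse. This transfers statements about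
columns to rows. -/
theorem lorentz_adjoint {n : ℕ} {g : Matrix (Fin 1 ⊕ Fin n) (Fin 1 ⊕ Fin n) ℝ}
    (hg : gᵀ * lorentz ℝ n * g = lorentz ℝ n) : g * lorentz ℝ n * gᵀ = lorentz ℝ n := by
  have h1 : (lorentz ℝ n * gᵀ * lorentz ℝ n) * g = 1 := by
    rw [Matrix.mul_assoc, Matrix.mul_assoc, ← Matrix.mul_assoc gᵀ, hg, lorentz_mul_lorentz]
  have h2 := mul_eq_one_comm.1 h1
  calc g * lorentz ℝ n * gᵀ
      = (g * (lorentz ℝ n * gᵀ * lorentz ℝ n)) * lorentz ℝ n := by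
        simp only [Matrix.mul_assoc, lorentz_mul_lorentz, Matrix.mul_one]
    _ = lorentz ℝ n := by rw [h2, Matrix.one_mul]

theorem col_sq {n : ℕ} {g : Matrix (Fin 1 ⊕ Fin n) (Fin 1 ⊕ Fin n) ℝ}
    (hg : gᵀ * lorentz ℝ n * g = lorentz ℝ n) :
    g (Sum.inl 0) (Sum.inl 0) ^ 2 - ∑ j, g (Sum.inr j) (Sum.inl 0) ^ 2 = 1 := by
  have h := dotProduct_lorentz_mulVec_mulVec hg (Pi.single (Sum.inl 0) 1)
    (Pi.single (Sum.inl 0) 1)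
  rw [dotProduct_lorentz_mulVec, dotProduct_lorentz_mulVec] at h
  simpa [sq] using h

theorem row_sq {n : ℕ} {g : Matrix (Fin 1 ⊕ Fin n) (Fin 1 ⊕ Fin n) ℝ}
    (hg : gᵀ * lorentz ℝ n * g = lorentz ℝ n) :
    g (Sum.inl 0) (Sum.inl 0) ^ 2 - ∑ j, g (Sum.inl 0) (Sum.inr j) ^ 2 = 1 := by
  have h := col_sq (g := gᵀ) (by rw [Matrix.transpose_transpose]; exact lorentz_adjoint hg)
  simpa using h

/-- Cauchy–Schwarz for a timelike vector against one in the closed cone. It yields both the closure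
of orthochronous matrices under products and the positivity behind the nonvanishing denominators of
the action. -/
theorem add_dotProduct_pos {n : ℕ} {a : ℝ} {b x : Fin n → ℝ} (ha : 0 < a)
    (hb : ∑ j, b j ^ 2 < a ^ 2) {r : ℝ} (hr : 0 < r) (hx : ∑ j, x j ^ 2 ≤ r ^ 2) :
    0 < a * r + ∑ j, b j * x j := by
  have h1 := Finset.sum_mul_sq_le_sq_mul_sq Finset.univ b x
  have h0 : 0 ≤ ∑ j, b j ^ 2 := Finset.sum_nonneg fun j _ => sq_nonneg _
  have h2 : (∑ j, b j * x j) ^ 2 < (a * r) ^ 2 := by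
    rw [mul_pow]
    calc _ ≤ _ := h1
      _ ≤ (∑ j, b j ^ 2) * r ^ 2 := by gcongr
      _ < a ^ 2 * r ^ 2 := by gcongr
  have h3 := abs_lt_of_sq_lt_sq h2 (by positivity)
  linarith [neg_abs_le (∑ j, b j * x j)]

namespace IsOrthochronous

variable {n : ℕ} {g h : Matrix (Fin 1 ⊕ Fin n) (Fin 1 ⊕ Fin n) ℝ}

theorem gram (hg : IsOrthochronous g) : gᵀ * lorentz ℝ n * g = lorentz ℝ n :=
  preserves_form_iff.1 hg.preserves

theorem row_lt (hg : IsOrthochronous g) :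
    ∑ j, g (Sum.inl 0) (Sum.inr j) ^ 2 < g (Sum.inl 0) (Sum.inl 0) ^ 2 := by
  linarith [row_sq hg.gram]

theorem one : IsOrthochronous (1 : Matrix (Fin 1 ⊕ Fin n) (Fin 1 ⊕ Fin n) ℝ) :=
  ⟨fun x y => by simp, by simp⟩

theorem mul (hg : IsOrthochronous g) (hh : IsOrthochronous h) : IsOrthochronous (g * h) := by
  refine ⟨fun x y => ?_, ?_⟩
  · rw [← Matrix.mulVec_mulVec, ← Matrix.mulVec_mulVec, hg.preserves, hh.preserves]
  · have := add_dotProduct_pos (x := fun j => h (Sum.inr j) (Sum.inl 0)) hg.pos hg.row_lt hh.pos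
      (by linarith [col_sq hh.gram])
    simpa [Matrix.mul_apply] using this

theorem det_sq (hg : IsOrthochronous g) : g.det ^ 2 = 1 := by
  have h1 := congrArg Matrix.det hg.gram
  rw [Matrix.det_mul, Matrix.det_mul, Matrix.det_transpose] at h1
  have h2 := congrArg Matrix.det (lorentz_mul_lorentz ℝ n)
  rw [Matrix.det_mul, Matrix.det_one] at h2
  linear_combination (lorentz ℝ n).det * h1 - (g.det ^ 2 - 1) * h2

theorem gram_complex (hg : IsOrthochronous g) :
    (g.map Complex.ofRealHom)ᵀ * lorentz ℂ n * g.map Complex.ofRealHom = lorentz ℂ n := by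
  have h1 : lorentz ℂ n = (lorentz ℝ n).map Complex.ofRealHom := by
    rw [lorentz, lorentz, Matrix.diagonal_map (by simp)]
    congr 1
    ext i
    rcases i with i | i <;> simp
  rw [h1, ← Matrix.transpose_map, ← Matrix.map_mul, ← Matrix.map_mul, hg.gram]

end IsOrthochronous

/-! ### The action of Lorentz matrices on the Lie ball -/

/-- The vector `((1 + q)/2, z)`, where `q = z zᵗ`. -/
noncomputable def lift {n : ℕ} (z : EuclideanSpace ℂ (Fin n)) : Fin 1 ⊕ Fin n → ℂ :=
  Sum.elim (fun _ => (1 + quad z) / 2) fun j => z j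

/-- The image of `lift z` under a real matrix. -/
noncomputable def liftImage {n : ℕ} (g : Matrix (Fin 1 ⊕ Fin n) (Fin 1 ⊕ Fin n) ℝ)
    (z : EuclideanSpace ℂ (Fin n)) : Fin 1 ⊕ Fin n → ℂ :=
  g.map Complex.ofRealHom *ᵥ lift z

/-- The automorphy factor of the action on the Lie ball. -/
noncomputable def factor {n : ℕ} (g : Matrix (Fin 1 ⊕ Fin n) (Fin 1 ⊕ Fin n) ℝ)
    (z : EuclideanSpace ℂ (Fin n)) : ℂ :=
  liftImage g z (Sum.inl 0) + (1 - quad z) / 2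

/-- The action of Lorentz matrices on the Lie ball by conformal transformations. -/
noncomputable def act {n : ℕ} (g : Matrix (Fin 1 ⊕ Fin n) (Fin 1 ⊕ Fin n) ℝ)
    (z : EuclideanSpace ℂ (Fin n)) : EuclideanSpace ℂ (Fin n) :=
  WithLp.toLp 2 fun j => (factor g z)⁻¹ * liftImage g z (Sum.inr j)

theorem liftImage_apply {n : ℕ} (g : Matrix (Fin 1 ⊕ Fin n) (Fin 1 ⊕ Fin n) ℝ)
    (z : EuclideanSpace ℂ (Fin n)) (k : Fin 1 ⊕ Fin n) :
    liftImage g z k = (g k (Sum.inl 0) : ℂ) * ((1 + quad z) / 2) +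
      ∑ j, (g k (Sum.inr j) : ℂ) * z j := by
  simp [liftImage, Matrix.mulVec, dotProduct, lift]

section

variable {n : ℕ} {g : Matrix (Fin 1 ⊕ Fin n) (Fin 1 ⊕ Fin n) ℝ} {z : EuclideanSpace ℂ (Fin n)}

/-- The Lorentz square of `lift z` is `((1+q)/2)² - q = ((1-q)/2)²`, and `g` preserves it. -/
theorem liftImage_null (hg : IsOrthochronous g) :
    liftImage g z (Sum.inl 0) ^ 2 - ∑ j, liftImage g z (Sum.inr j) ^ 2 =
      ((1 - quad z) / 2) ^ 2 := by
  have h := dotProduct_lorentz_mulVec_mulVec hg.gram_complex (lift z) (lift z)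
  rw [dotProduct_lorentz_mulVec, dotProduct_lorentz_mulVec] at h
  simp only [sq, liftImage]
  rw [h]
  simp only [lift, Sum.elim_inl, Sum.elim_inr]
  have : ∑ j, z j * z j = quad z := by simp [quad, sq]
  rw [this]
  ring

/-- Since `g` is real it commutes with conjugation, so it preserves the sesquilinear form as well.
-/
theorem liftImage_hermitian (hg : IsOrthochronous g) :
    ‖liftImage g z (Sum.inl 0)‖ ^ 2 - ∑ j, ‖liftImage g z (Sum.inr j)‖ ^ 2 =
      ‖(1 + quad z) / 2‖ ^ 2 - ‖z‖ ^ 2 := by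
  have hc : ∀ k, conj (liftImage g z k) =
      (g.map Complex.ofRealHom *ᵥ fun k => conj (lift z k)) k := by
    intro k
    simp [liftImage, Matrix.mulVec, dotProduct]
  have h := dotProduct_lorentz_mulVec_mulVec hg.gram_complex (lift z) fun k => conj (lift z k)
  rw [dotProduct_lorentz_mulVec, dotProduct_lorentz_mulVec] at h
  simp only [← hc] at h
  change liftImage g z _ * _ - ∑ j, liftImage g z _ * _ = _ at h
  simp only [lift, Sum.elim_inl, Sum.elim_inr] at h
  rw [← ofReal_norm_sq] at h
  simp only [Complex.mul_conj'] at h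
  exact_mod_cast h

/-- Substitutes `z = X (1+q)/2 - Y i(1-q)/2`. The real coefficients that appear are the entries of
the blocks of `θ(g)` applied to `Z`. -/
theorem liftImage_eq_hua (hz : z ∈ lieBall n) (k : Fin 1 ⊕ Fin n) :
    liftImage g z k =
      ((g k (Sum.inl 0) + ∑ j, g k (Sum.inr j) * hua z j 0 : ℝ) : ℂ) * ((1 + quad z) / 2) -
      ((∑ j, g k (Sum.inr j) * hua z j 1 : ℝ) : ℂ) * (Complex.I * ((1 - quad z) / 2)) := by
  rw [liftImage_apply]
  push_cast
  rw [add_mul, add_sub_assoc, Finset.sum_mul, Finset.sum_mul, ← Finset.sum_sub_distrib]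
  congr 1
  refine Finset.sum_congr rfl fun j _ => ?_
  linear_combination -(g k (Sum.inr j) : ℂ) / 2 * hua_linear (norm_quad_lt_one hz) j

theorem row_hua_pos (hg : IsOrthochronous g) (hz : z ∈ lieBall n) :
    0 < g (Sum.inl 0) (Sum.inl 0) + ∑ j, g (Sum.inl 0) (Sum.inr j) * hua z j 0 := by
  have h := (mem_matBall_iff_entries.1 (hua_mem_matBall hz)).1
  have := add_dotProduct_pos (x := fun j => hua z j 0) hg.pos hg.row_lt one_pos (by simpa using h.le)
  simpa using this

/-- Up to an imaginary term the product is `u (1 - |q|²)/4`, with `u > 0` from `row_hua_pos`. -/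
theorem re_liftImage_pos (hg : IsOrthochronous g) (hz : z ∈ lieBall n) :
    0 < (liftImage g z (Sum.inl 0) * conj ((1 - quad z) / 2)).re := by
  have h1 := row_hua_pos hg hz
  rw [liftImage_eq_hua hz]
  set u := g (Sum.inl 0) (Sum.inl 0) + ∑ j, g (Sum.inl 0) (Sum.inr j) * hua z j 0
  set v := ∑ j, g (Sum.inl 0) (Sum.inr j) * hua z j 1
  have h2 : ((u : ℂ) * ((1 + quad z) / 2) - (v : ℂ) * (Complex.I * ((1 - quad z) / 2))) *
      conj ((1 - quad z) / 2) =
      ((u * (1 - ‖quad z‖ ^ 2) / 4 : ℝ) : ℂ) +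
        ((u * (quad z).im / 2 - v * ‖(1 - quad z) / 2‖ ^ 2 : ℝ) : ℂ) * Complex.I := by
    have h3 := Complex.sub_conj (quad z)
    push_cast at h3 ⊢
    rw [← Complex.mul_conj', ← Complex.mul_conj']
    simp only [map_div₀, map_sub, map_one, map_ofNat]
    linear_combination (u : ℂ) / 4 * h3
  rw [h2, Complex.add_re, Complex.re_ofReal_mul, Complex.I_re, mul_zero, add_zero,
    Complex.ofReal_re]
  have := norm_quad_lt_one hz
  have : 0 < 1 - ‖quad z‖ ^ 2 := by nlinarith [norm_nonneg (quad z)]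
  positivity

/-- If `Re(v w̄) > 0` then `|v - w| < |v + w|`. This gives at once a nonzero denominator and `|q| <
1` at the image point. -/
theorem norm_sub_lt_norm_factor (hg : IsOrthochronous g) (hz : z ∈ lieBall n) :
    ‖liftImage g z (Sum.inl 0) - (1 - quad z) / 2‖ < ‖factor g z‖ := by
  have h := re_liftImage_pos hg hz
  refine lt_of_pow_lt_pow_left₀ 2 (norm_nonneg _) ?_
  rw [factor, ← Complex.normSq_eq_norm_sq, ← Complex.normSq_eq_norm_sq, Complex.normSq_sub,
    Complex.normSq_add]
  linarith

theorem factor_ne_zero (hg : IsOrthochronous g) (hz : z ∈ lieBall n) : factor g z ≠ 0 :=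
  norm_pos_iff.1 (lt_of_le_of_lt (norm_nonneg _) (norm_sub_lt_norm_factor hg hz))

/-- By `liftImage_null` the sum of the squares `v_j²` is `v₀² - w² = (v₀ - w)(v₀ + w)`, and `v₀ + w`
is the factor. -/
theorem quad_act (hg : IsOrthochronous g) (hz : z ∈ lieBall n) :
    quad (act g z) = (liftImage g z (Sum.inl 0) - (1 - quad z) / 2) / factor g z := by
  have h0 := factor_ne_zero hg hz
  have h1 := liftImage_null (z := z) hg
  have h2 : quad (act g z) * factor g z ^ 2 = ∑ j, liftImage g z (Sum.inr j) ^ 2 := by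
    simp only [quad, act, mul_pow]
    rw [← Finset.mul_sum, inv_pow]
    field_simp
  rw [eq_div_iff h0]
  apply mul_right_cancel₀ h0
  rw [mul_assoc, ← sq, h2, factor]
  linear_combination -h1

theorem factor_mul_one_sub_quad_act (hg : IsOrthochronous g) (hz : z ∈ lieBall n) :
    factor g z * (1 - quad (act g z)) = 1 - quad z := by
  have h0 := factor_ne_zero hg hz
  rw [quad_act hg hz, mul_sub, mul_div_cancel₀ _ h0, factor]
  ring

theorem factor_smul_lift_act (hg : IsOrthochronous g) (hz : z ∈ lieBall n) :
    factor g z • lift (act g z) = liftImage g z := by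
  have h0 := factor_ne_zero hg hz
  ext k
  rcases k with k | k
  · rw [Subsingleton.elim k 0]
    simp only [Pi.smul_apply, lift, Sum.elim_inl, smul_eq_mul]
    have h1 : factor g z * quad (act g z) =
        liftImage g z (Sum.inl 0) - (1 - quad z) / 2 := by
      rw [quad_act hg hz, mul_div_cancel₀ _ h0]
    have h2 : factor g z = liftImage g z (Sum.inl 0) + (1 - quad z) / 2 := rfl
    linear_combination (1 / 2 : ℂ) * h1 + (1 / 2 : ℂ) * h2
  · simp only [Pi.smul_apply, lift, Sum.elim_inr, smul_eq_mul, act]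
    exact mul_inv_cancel_left₀ h0 _

/-- The expression `1 - 2|z|² + |q|²` is multiplied by `|factor|⁻²` under the action: it is twice
the invariant Hermitian form of the null vector, by the parallelogram law. -/
theorem act_mem_lieBall (hg : IsOrthochronous g) (hz : z ∈ lieBall n) : act g z ∈ lieBall n := by
  have h0 := factor_ne_zero hg hz
  have hpos : 0 < ‖factor g z‖ := norm_pos_iff.2 h0
  rw [mem_lieBall_iff, quad_act hg hz, norm_div]
  refine ⟨?_, (div_lt_one hpos).2 (norm_sub_lt_norm_factor hg hz)⟩
  have h1 : ‖act g z‖ ^ 2 = (∑ j, ‖liftImage g z (Sum.inr j)‖ ^ 2) / ‖factor g z‖ ^ 2 := by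
    rw [EuclideanSpace.norm_sq_eq]
    simp only [act, norm_mul, norm_inv, mul_pow]
    rw [← Finset.mul_sum, inv_pow]
    field_simp
  have h2 := liftImage_hermitian (z := z) hg
  have h3 := (mem_lieBall_iff.1 hz).1
  have h4 : ‖factor g z‖ ^ 2 + ‖liftImage g z (Sum.inl 0) - (1 - quad z) / 2‖ ^ 2 =
      2 * (‖liftImage g z (Sum.inl 0)‖ ^ 2 + ‖(1 - quad z) / 2‖ ^ 2) := by
    exact parallelogram_law_with_norm ℝ (liftImage g z (Sum.inl 0)) ((1 - quad z) / 2)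
  have h5 : ‖(1 + quad z) / 2‖ ^ 2 + ‖(1 - quad z) / 2‖ ^ 2 = (1 + ‖quad z‖ ^ 2) / 2 := by
    have := parallelogram_law_with_norm ℝ (1 : ℂ) (quad z)
    rw [norm_div, norm_div, norm_one] at *
    simp only [Complex.norm_ofNat]
    linarith
  have h6 : 0 < (1 - 2 * ‖z‖ ^ 2 + ‖quad z‖ ^ 2) / ‖factor g z‖ ^ 2 := by positivity
  rw [h1, div_pow]
  convert h6 using 1
  rw [eq_div_iff (by positivity)]
  have h7 : ‖factor g z‖ ^ 2 ≠ 0 := by positivity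
  rw [add_mul, sub_mul, div_mul_cancel₀ _ h7, mul_assoc, div_mul_cancel₀ _ h7]
  linarith

theorem act_one : act 1 z = z := by
  have h : liftImage 1 z = lift z := by
    rw [liftImage, Matrix.map_one _ (by simp) (by simp), Matrix.one_mulVec]
  have h1 : factor 1 z = 1 := by
    rw [factor, h, lift, Sum.elim_inl]
    ring
  ext j
  simp [act, h1, h, lift]

theorem act_mul (g : Matrix (Fin 1 ⊕ Fin n) (Fin 1 ⊕ Fin n) ℝ)
    {h : Matrix (Fin 1 ⊕ Fin n) (Fin 1 ⊕ Fin n) ℝ} (hh : IsOrthochronous h)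
    (hz : z ∈ lieBall n) : act (g * h) z = act g (act h z) := by
  have h0 := factor_ne_zero hh hz
  have h1 : liftImage (g * h) z = factor h z • liftImage g (act h z) := by
    rw [liftImage, Matrix.map_mul, ← Matrix.mulVec_mulVec, ← liftImage,
      ← factor_smul_lift_act hh hz, Matrix.mulVec_smul]
    rfl
  have h2 : factor (g * h) z = factor h z * factor g (act h z) := by
    simp only [factor.eq_1 (g * h), factor.eq_1 g, h1, Pi.smul_apply, smul_eq_mul]
    linear_combination -(1 / 2 : ℂ) * factor_mul_one_sub_quad_act hh hz
  ext j
  simp only [act]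
  rw [h2, h1, Pi.smul_apply, smul_eq_mul, mul_inv]
  change _ = (factor g (act h z))⁻¹ * liftImage g (act h z) (Sum.inr j)
  field_simp

theorem conj_liftImage_ofRealVec (x : EuclideanSpace ℝ (Fin n)) (k : Fin 1 ⊕ Fin n) :
    conj (liftImage g (ofRealVec x) k) = liftImage g (ofRealVec x) k := by
  rw [liftImage_apply, quad_ofRealVec]
  simp [ofRealVec, Complex.conj_ofNat]

theorem act_mem_realPart (hg : IsOrthochronous g) (hz : z ∈ realPart n) :
    act g z ∈ realPart n := by
  obtain ⟨hz, x, rfl⟩ := hz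
  refine ⟨act_mem_lieBall hg hz, WithLp.toLp 2 fun j => (act g (ofRealVec x) j).re, ?_⟩
  ext j
  change ((act g (ofRealVec x) j).re : ℂ) = _
  refine Complex.conj_eq_iff_re.1 ?_
  simp only [act, factor, map_mul, map_inv₀, map_add, conj_liftImage_ofRealVec]
  simp [quad_ofRealVec, Complex.conj_ofNat]

/-- For `|q| < 1` the quotient `(1+q)/(1-q)` has positive real part, so `(1+q)/2` and `i(1-q)/2` are
linearly independent over `ℝ`: one complex equation splits into two real ones. -/
theorem eq_zero_of_mul_eq {q : ℂ} (hq : ‖q‖ < 1) {p r : ℝ}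
    (h : (p : ℂ) * ((1 + q) / 2) = (r : ℂ) * (Complex.I * ((1 - q) / 2))) : p = 0 ∧ r = 0 := by
  have hq2 : 0 < 1 - ‖q‖ ^ 2 := by nlinarith [norm_nonneg q]
  rw [← Complex.normSq_eq_norm_sq, Complex.normSq_apply] at hq2
  have h1 := congrArg Complex.re h
  have h2 := congrArg Complex.im h
  simp at h1 h2
  have hp : p = 0 := by
    have : p * (1 - (q.re * q.re + q.im * q.im)) = 0 := by
      linear_combination 2 * (1 - q.re) * h1 - 2 * q.im * h2
    exact (mul_eq_zero.1 this).resolve_right hq2.ne'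
  refine ⟨hp, ?_⟩
  rw [hp] at h2
  have h3 : r * (1 - q.re) = 0 := by linarith
  refine (mul_eq_zero.1 h3).resolve_right ?_
  nlinarith [sq_nonneg q.im]

theorem hua_act {g : SO 1 n} (hg : IsOrthochronous (soMat g)) (hz : z ∈ lieBall n) :
    hua (act (soMat g) z) = mobius (theta n g) (hua z) := by
  have hu := row_hua_pos hg hz
  set a := soMat g with ha
  have hs : soMat (theta n g) = thetaMat a := rfl
  set u := a (Sum.inl 0) (Sum.inl 0) + ∑ j, a (Sum.inl 0) (Sum.inr j) * hua z j 0 with hu'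
  set v := ∑ j, a (Sum.inl 0) (Sum.inr j) * hua z j 1 with hv'
  -- The second row is `(0, 1)` because `θ(g)` fixes the second coordinate, so invertibility reduces
  -- to `u > 0`.
  have hN : (thetaMat a).toBlocks₁₁ + (thetaMat a).toBlocks₁₂ * hua z = !![u, v; 0, 1] := by
    ext i j
    fin_cases i <;> fin_cases j <;>
      simp [thetaMat, Matrix.vecMul, dotProduct, hu', hv']
  have hdet : IsUnit (!![u, v; 0, 1] : Matrix (Fin 2) (Fin 2) ℝ).det := by
    simp [Matrix.det_fin_two_of, hu.ne']
  rw [mobius, hs, hN]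
  suffices h : (thetaMat a).toBlocks₂₁ + (thetaMat a).toBlocks₂₂ * hua z =
      hua (act a z) * !![u, v; 0, 1] by
    rw [h, Matrix.mul_nonsing_inv_cancel_right _ _ hdet]
  have key : ∀ j, a (Sum.inr j) (Sum.inl 0) + ∑ k, a (Sum.inr j) (Sum.inr k) * hua z k 0 =
        u * hua (act a z) j 0 ∧
      ∑ k, a (Sum.inr j) (Sum.inr k) * hua z k 1 =
        v * hua (act a z) j 0 + hua (act a z) j 1 := by
    intro j
    have e1 := liftImage_eq_hua (g := a) hz (Sum.inr j)
    have e2 := liftImage_eq_hua (g := a) hz (Sum.inl 0)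
    have e3 := hua_linear (norm_quad_lt_one (act_mem_lieBall hg hz)) j
    have e4 := congrFun (factor_smul_lift_act hg hz) (Sum.inl 0)
    have e5 := congrFun (factor_smul_lift_act hg hz) (Sum.inr j)
    have e6 := factor_mul_one_sub_quad_act hg hz
    simp only [Pi.smul_apply, smul_eq_mul, lift, Sum.elim_inl, Sum.elim_inr] at e4 e5
    rw [← hu', ← hv'] at e2
    set P := a (Sum.inr j) (Sum.inl 0) + ∑ k, a (Sum.inr j) (Sum.inr k) * hua z k 0
    set Q := ∑ k, a (Sum.inr j) (Sum.inr k) * hua z k 1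
    set S := hua (act a z) j 0
    set T := hua (act a z) j 1
    -- The component `j` of `g` applied to `lift z` is written twice, through `hua z` and through
    -- `hua (act a z)`; `e7` compares the two.
    have e7 : ((P - u * S : ℝ) : ℂ) * ((1 + quad z) / 2) =
        ((Q - v * S - T : ℝ) : ℂ) * (Complex.I * ((1 - quad z) / 2)) := by
      push_cast
      linear_combination -e5 - e1 + S * e2 - factor a z / 2 * e3 + S * e4 -
        (Complex.I * T / 2) * e6
    obtain ⟨e8, e9⟩ := eq_zero_of_mul_eq (norm_quad_lt_one hz) e7
    exact ⟨sub_eq_zero.1 e8, by linarith⟩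
  ext j k
  fin_cases k
  · simpa [thetaMat, Matrix.mul_apply, Matrix.toBlocks₂₂, mul_comm] using (key j).1
  · simpa [thetaMat, Matrix.mul_apply, Matrix.toBlocks₂₂, mul_comm] using (key j).2

end

/-! ### Holomorphy and continuity of the action -/

theorem differentiable_quad {n : ℕ} : Differentiable ℂ (quad (n := n)) := by
  unfold quad
  fun_prop

theorem isOpen_lieBall (n : ℕ) : IsOpen (lieBall n) := by
  have h := (differentiable_quad (n := n)).continuous
  have h1 : Continuous fun z : EuclideanSpace ℂ (Fin n) => 1 - 2 * ‖z‖ ^ 2 + ‖quad z‖ ^ 2 := by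
    fun_prop
  exact (isOpen_lt continuous_const h1).inter (isOpen_lt continuous_norm continuous_const)

theorem differentiable_liftImage {n : ℕ} (g : Matrix (Fin 1 ⊕ Fin n) (Fin 1 ⊕ Fin n) ℝ)
    (k : Fin 1 ⊕ Fin n) : Differentiable ℂ fun z => liftImage g z k := by
  have h := differentiable_quad (n := n)
  simp only [liftImage_apply]
  fun_prop

theorem differentiableOn_act {n : ℕ} {g : Matrix (Fin 1 ⊕ Fin n) (Fin 1 ⊕ Fin n) ℝ}
    (hg : IsOrthochronous g) : DifferentiableOn ℂ (act g) (lieBall n) := by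
  have h := differentiable_quad (n := n)
  have h1 : Differentiable ℂ (factor g) := by
    have := differentiable_liftImage g (Sum.inl 0)
    unfold factor
    fun_prop
  rw [differentiableOn_piLp]
  intro j
  exact (h1.differentiableOn.inv fun z hz => factor_ne_zero hg hz).mul
    (differentiable_liftImage g (Sum.inr j)).differentiableOn

theorem continuousOn_act {n : ℕ} :
    ContinuousOn (fun p : Matrix (Fin 1 ⊕ Fin n) (Fin 1 ⊕ Fin n) ℝ × EuclideanSpace ℂ (Fin n) =>
      act p.1 p.2) ({g | IsOrthochronous g} ×ˢ lieBall n) := by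
  have h := (differentiable_quad (n := n)).continuous
  have h1 : ∀ k, Continuous fun p : Matrix (Fin 1 ⊕ Fin n) (Fin 1 ⊕ Fin n) ℝ ×
      EuclideanSpace ℂ (Fin n) => liftImage p.1 p.2 k := by
    intro k
    simp only [liftImage_apply]
    fun_prop
  have h2 : Continuous fun p : Matrix (Fin 1 ⊕ Fin n) (Fin 1 ⊕ Fin n) ℝ ×
      EuclideanSpace ℂ (Fin n) => factor p.1 p.2 := by
    have := h1 (Sum.inl 0)
    unfold factor
    fun_prop
  refine (PiLp.continuous_toLp 2 _).comp_continuousOn (continuousOn_pi.2 fun j => ?_)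
  exact (h2.continuousOn.inv₀ fun p hp => factor_ne_zero hp.1 hp.2).mul (h1 _).continuousOn

/-- The automorphism of the Lie ball given by a Lorentz matrix `g` with inverse `h`. -/
noncomputable def actAut {n : ℕ} (g h : Matrix (Fin 1 ⊕ Fin n) (Fin 1 ⊕ Fin n) ℝ)
    (hg : IsOrthochronous g) (hh : IsOrthochronous h) (hgh : g * h = 1) (hhg : h * g = 1) :
    aut n where
  val :=
    { toFun := fun z => ⟨act g z, act_mem_lieBall hg z.2⟩
      invFun := fun z => ⟨act h z, act_mem_lieBall hh z.2⟩
      left_inv := fun z => Subtype.ext <| by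
        change act h (act g z) = z
        rw [← act_mul h hg z.2, hhg, act_one]
      right_inv := fun z => Subtype.ext <| by
        change act g (act h z) = z
        rw [← act_mul g hh z.2, hgh, act_one]
      continuous_toFun :=
        (continuousOn_iff_continuous_domRestrict.1 (differentiableOn_act hg).continuousOn).subtype_mk _
      continuous_invFun :=
        (continuousOn_iff_continuous_domRestrict.1
          (differentiableOn_act hh).continuousOn).subtype_mk _ }
  property := ⟨⟨act g, differentiableOn_act hg, fun _ => rfl⟩,
    ⟨act h, differentiableOn_act hh, fun _ => rfl⟩⟩

/-! ### Holomorphic maps are determined by their values on the real part -/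

theorem zero_mem_lieBall (n : ℕ) : (0 : EuclideanSpace ℂ (Fin n)) ∈ lieBall n := by
  simp [lieBall, quad]

theorem quad_smul {n : ℕ} (c : ℂ) (z : EuclideanSpace ℂ (Fin n)) :
    quad (c • z) = c ^ 2 * quad z := by
  simp [quad, mul_pow, Finset.mul_sum]

/-- Scaling raises the defining expression by `(1 - |c|²)(2|z|² - (1 + |c|²)|q|²) ≥ 0`. -/
theorem smul_mem_lieBall {n : ℕ} {c : ℂ} {z : EuclideanSpace ℂ (Fin n)} (hc : ‖c‖ ≤ 1)
    (hz : z ∈ lieBall n) : c • z ∈ lieBall n := by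
  obtain ⟨h1, h2⟩ := hz
  have h3 := norm_quad_le z
  have h4 := norm_nonneg (quad z)
  have h5 := norm_nonneg z
  have h6 := norm_nonneg c
  have ht : ‖c‖ ^ 2 ≤ 1 := by nlinarith
  refine ⟨?_, ?_⟩
  · rw [norm_smul, quad_smul, norm_mul, norm_pow]
    have h7 : ‖quad z‖ ^ 2 ≤ ‖z‖ ^ 2 := pow_le_pow_left₀ h4 (by nlinarith) 2
    have h8 : 0 ≤ (1 - ‖c‖ ^ 2) * (2 * ‖z‖ ^ 2 - (1 + ‖c‖ ^ 2) * ‖quad z‖ ^ 2) := by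
      refine mul_nonneg (by linarith) ?_
      nlinarith [sq_nonneg ‖quad z‖]
    nlinarith
  · rw [norm_smul]
    nlinarith

/-- Here the defining expression is `(1 - |c|²)²`. Real unit directions thus carry full unit discs,
which makes the Schwarz lemma sharp along them; isotropic directions do not. -/
theorem smul_ofRealVec_mem_lieBall {n : ℕ} {c : ℂ} {x : EuclideanSpace ℝ (Fin n)}
    (hc : ‖c‖ < 1) (hx : ‖x‖ = 1) : c • ofRealVec x ∈ lieBall n := by
  rw [mem_lieBall_iff, norm_smul, quad_smul, norm_mul, quad_ofRealVec, norm_ofRealVec, hx]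
  simp only [norm_pow, one_pow, Complex.ofReal_one, norm_one, mul_one]
  have h : 0 < 1 - ‖c‖ ^ 2 := by nlinarith [norm_nonneg c]
  exact ⟨by nlinarith [mul_pos h h], by linarith⟩

theorem ball_half_subset_lieBall {n : ℕ} {z : EuclideanSpace ℂ (Fin n)} (hz : ‖z‖ < 1 / 2) :
    z ∈ lieBall n := by
  have := norm_nonneg z
  refine ⟨?_, by linarith⟩
  nlinarith [sq_nonneg ‖quad z‖]

/-- Two one-variable identity principles: near `0`, along `c ↦ x + c y`, which is real for real `c`
and reaches `x + iy` at `c = i`; then along `c ↦ c z`, since the Lie ball is star-shaped about `0`.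
-/
theorem eq_zero_of_eq_zero_on_real {n : ℕ}
    {F : EuclideanSpace ℂ (Fin n) → EuclideanSpace ℂ (Fin n)}
    (hF : DifferentiableOn ℂ F (lieBall n)) (h0 : ∀ x, ‖x‖ < 1 → F (ofRealVec x) = 0)
    {z : EuclideanSpace ℂ (Fin n)} (hz : z ∈ lieBall n) : F z = 0 := by
  have small : ∀ w : EuclideanSpace ℂ (Fin n), ‖w‖ < 1 / 2 → F w = 0 := by
    intro w hw
    set x : EuclideanSpace ℝ (Fin n) := WithLp.toLp 2 fun j => (w j).re with hx
    set y : EuclideanSpace ℝ (Fin n) := WithLp.toLp 2 fun j => (w j).im with hy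
    have hw' : w = ofRealVec x + Complex.I • ofRealVec y := by
      ext j
      simp [ofRealVec, hx, hy, mul_comm Complex.I]
    have hx1 : ‖ofRealVec x‖ < 1 / 2 := by
      refine lt_of_le_of_lt ?_ hw
      rw [norm_ofRealVec, EuclideanSpace.norm_eq, EuclideanSpace.norm_eq]
      refine Real.sqrt_le_sqrt (Finset.sum_le_sum fun j _ => ?_)
      exact pow_le_pow_left₀ (norm_nonneg _) (Complex.abs_re_le_norm _) 2
    set ℓ : ℂ → EuclideanSpace ℂ (Fin n) := fun c => ofRealVec x + c • ofRealVec y with hl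
    have hd : Differentiable ℂ ℓ := by
      simp only [hl]
      fun_prop
    -- A ball inside the Lie ball, so that the slice is convex, hence connected.
    set U := ℓ ⁻¹' Metric.ball 0 (1 / 2) with hU
    have hUo : IsOpen U := Metric.isOpen_ball.preimage hd.continuous
    have hUc : Convex ℝ U := by
      intro a ha b hb s t hs ht hst
      have e : ℓ (s • a + t • b) = s • ℓ a + t • ℓ b := by
        have e1 : (s : ℂ) + t = 1 := by exact_mod_cast hst
        ext j
        simp only [hl, PiLp.add_apply, PiLp.smul_apply, smul_eq_mul, Complex.real_smul]
        linear_combination -(ofRealVec x j) * e1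
      change ℓ _ ∈ Metric.ball 0 (1 / 2)
      rw [e]
      exact convex_ball _ _ ha hb hs ht hst
    have hA : AnalyticOnNhd ℂ (F ∘ ℓ) U := by
      refine DifferentiableOn.analyticOnNhd (hF.comp hd.differentiableOn fun c hc => ?_) hUo
      exact ball_half_subset_lieBall (mem_ball_zero_iff.1 hc)
    have h0U : (0 : ℂ) ∈ U := by
      simpa [hU, hl] using hx1
    have hfreq : ∃ᶠ c in nhdsWithin (0 : ℂ) {0}ᶜ, (F ∘ ℓ) c = 0 := by
      have ht : Filter.Tendsto (fun t : ℝ => (t : ℂ)) (nhdsWithin 0 {0}ᶜ)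
          (nhdsWithin (0 : ℂ) {0}ᶜ) := by
        refine tendsto_nhdsWithin_of_tendsto_nhds_of_eventually_within _ ?_ ?_
        · exact (Complex.continuous_ofReal.tendsto' 0 0 (by simp)).mono_left nhdsWithin_le_nhds
        · filter_upwards [self_mem_nhdsWithin] with t ht
          simpa using ht
      refine ht.frequently (Filter.Eventually.frequently ?_)
      have hev : ∀ᶠ t : ℝ in nhds 0, ((t : ℂ)) ∈ U :=
        (Complex.continuous_ofReal.tendsto' 0 0 (by simp)).eventually (hUo.mem_nhds h0U)
      filter_upwards [nhdsWithin_le_nhds hev] with t ht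
      have e : ℓ t = ofRealVec (x + t • y) := by
        ext j
        simp [hl, ofRealVec]
      have ht' : ‖ℓ t‖ < 1 / 2 := mem_ball_zero_iff.1 ht
      rw [e, norm_ofRealVec] at ht'
      rw [Function.comp_apply, e]
      exact h0 _ (by linarith)
    have := hA.eqOn_zero_of_preconnected_of_frequently_eq_zero hUc.isPreconnected h0U hfreq
      (show Complex.I ∈ U by simpa [hU, hl, ← hw'] using hw)
    rw [hw']
    exact this
  set ℓ : ℂ → EuclideanSpace ℂ (Fin n) := fun c => c • z with hl
  have hd : Differentiable ℂ ℓ := by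
    simp only [hl]
    fun_prop
  set U := ℓ ⁻¹' lieBall n with hU
  have hUo : IsOpen U := (isOpen_lieBall n).preimage hd.continuous
  have h0U : (0 : ℂ) ∈ U := by
    simpa [hU, hl] using zero_mem_lieBall n
  have hUc : IsPreconnected U := by
    refine (StarConvex.isPathConnected (a := 0) ?_ h0U).isConnected.isPreconnected
    intro c hc s t hs ht hst
    have e : ℓ (s • 0 + t • c) = (t : ℂ) • ℓ c := by
      simp [hl, mul_smul]
    change ℓ _ ∈ lieBall n
    rw [e]
    refine smul_mem_lieBall ?_ hc
    rw [Complex.norm_real, Real.norm_of_nonneg ht]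
    linarith
  have hA : AnalyticOnNhd ℂ (F ∘ ℓ) U :=
    DifferentiableOn.analyticOnNhd (hF.comp hd.differentiableOn fun c hc => hc) hUo
  have hev : (F ∘ ℓ) =ᶠ[nhds 0] 0 := by
    have : ∀ᶠ c in nhds (0 : ℂ), ‖ℓ c‖ < 1 / 2 :=
      (hd.continuous.norm.tendsto' 0 0 (by simp [hl])).eventually (gt_mem_nhds (by norm_num))
    filter_upwards [this] with c hc
    exact small _ hc
  have := hA.eqOn_zero_of_preconnected_of_eventuallyEq_zero hUc h0U hev
    (show (1 : ℂ) ∈ U by simpa [hU, hl] using hz)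
  simpa [hl] using this

/-! ### Automorphisms fixing the origin and preserving the real part -/

theorem hasDerivAt_slice {n : ℕ} {F : EuclideanSpace ℂ (Fin n) → EuclideanSpace ℂ (Fin n)}
    (hF : DifferentiableOn ℂ F (lieBall n)) (v : EuclideanSpace ℂ (Fin n)) :
    HasDerivAt (fun c : ℂ => F (c • v)) (fderiv ℂ F 0 v) 0 := by
  have h1 : HasFDerivAt F (fderiv ℂ F 0) ((0 : ℂ) • v) := by
    rw [zero_smul]
    exact (hF.differentiableAt ((isOpen_lieBall n).mem_nhds (zero_mem_lieBall n))).hasFDerivAt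
  have h2 : HasDerivAt (fun c : ℂ => c • v) v 0 := by
    simpa using (hasDerivAt_id (0 : ℂ)).smul_const v
  exact h1.comp_hasDerivAt 0 h2

theorem differentiableOn_slice {n : ℕ} {F : EuclideanSpace ℂ (Fin n) → EuclideanSpace ℂ (Fin n)}
    (hF : DifferentiableOn ℂ F (lieBall n)) {x : EuclideanSpace ℝ (Fin n)} (hx : ‖x‖ = 1) :
    DifferentiableOn ℂ (fun c : ℂ => F (c • ofRealVec x)) (Metric.ball 0 1) :=
  hF.comp (by fun_prop) fun _ hc => smul_ofRealVec_mem_lieBall (mem_ball_zero_iff.1 hc) hx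

theorem mapsTo_slice {n : ℕ} {F : EuclideanSpace ℂ (Fin n) → EuclideanSpace ℂ (Fin n)}
    (hm : Set.MapsTo F (lieBall n) (lieBall n)) (h0 : F 0 = 0)
    {x : EuclideanSpace ℝ (Fin n)} (hx : ‖x‖ = 1) :
    Set.MapsTo (fun c : ℂ => F (c • ofRealVec x)) (Metric.ball 0 1)
      (Metric.closedBall (F ((0 : ℂ) • ofRealVec x)) 1) := by
  intro c hc
  rw [zero_smul, h0, mem_closedBall_zero_iff]
  exact (hm (smul_ofRealVec_mem_lieBall (mem_ball_zero_iff.1 hc) hx)).2.le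

theorem norm_fderiv_ofRealVec_le {n : ℕ}
    {F : EuclideanSpace ℂ (Fin n) → EuclideanSpace ℂ (Fin n)}
    (hF : DifferentiableOn ℂ F (lieBall n)) (hm : Set.MapsTo F (lieBall n) (lieBall n))
    (h0 : F 0 = 0) {x : EuclideanSpace ℝ (Fin n)} (hx : ‖x‖ = 1) :
    ‖fderiv ℂ F 0 (ofRealVec x)‖ ≤ 1 := by
  have := Complex.norm_deriv_le_div_of_mapsTo_ball (differentiableOn_slice hF hx)
    (mapsTo_slice hm h0 hx) one_pos
  rwa [(hasDerivAt_slice hF _).deriv, div_one] at this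

theorem fderiv_ofRealVec_im {n : ℕ} {F : EuclideanSpace ℂ (Fin n) → EuclideanSpace ℂ (Fin n)}
    (hF : DifferentiableOn ℂ F (lieBall n))
    (hR : ∀ x, ‖x‖ < 1 → F (ofRealVec x) ∈ Set.range ofRealVec)
    (x : EuclideanSpace ℝ (Fin n)) (j : Fin n) : (fderiv ℂ F 0 (ofRealVec x) j).im = 0 := by
  have h1 : HasDerivAt (fun c : ℂ => F (c • ofRealVec x) j) (fderiv ℂ F 0 (ofRealVec x) j) 0 :=
    ((EuclideanSpace.proj j : EuclideanSpace ℂ (Fin n) →L[ℂ] ℂ).hasFDerivAt).comp_hasDerivAt 0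
      (hasDerivAt_slice hF (ofRealVec x))
  have h2 : HasDerivAt (fun t : ℝ => F ((t : ℂ) • ofRealVec x) j)
      (fderiv ℂ F 0 (ofRealVec x) j) 0 := by
    refine HasDerivAt.comp_ofReal (e := fun c : ℂ => F (c • ofRealVec x) j) ?_
    simpa using h1
  have h3 : HasDerivAt (fun t : ℝ => (F ((t : ℂ) • ofRealVec x) j).im)
      (fderiv ℂ F 0 (ofRealVec x) j).im 0 :=
    (Complex.imCLM.hasFDerivAt).comp_hasDerivAt 0 h2
  have h4 : (fun t : ℝ => (F ((t : ℂ) • ofRealVec x) j).im) =ᶠ[nhds 0] fun _ => 0 := by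
    have : ∀ᶠ t : ℝ in nhds 0, ‖t • x‖ < 1 :=
      (Continuous.tendsto' (by fun_prop) 0 0 (by simp)).eventually (gt_mem_nhds one_pos)
    filter_upwards [this] with t ht
    have e : (t : ℂ) • ofRealVec x = ofRealVec (t • x) := by
      ext j
      simp [ofRealVec]
    obtain ⟨y, hy⟩ := hR _ ht
    rw [e, ← hy]
    simp [ofRealVec]
  exact h3.unique ((hasDerivAt_const 0 0).congr_of_eventuallyEq h4)

/-- Schwarz for `F` and for `F'` bounds the derivative on real unit vectors from both sides.
Equality makes `F` linear on each real ray, and agreement on the real ball spreads to the Lie ball.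
-/
theorem eq_fderiv_of_fixes_zero {n : ℕ}
    {F F' : EuclideanSpace ℂ (Fin n) → EuclideanSpace ℂ (Fin n)}
    (hF : DifferentiableOn ℂ F (lieBall n)) (hm : Set.MapsTo F (lieBall n) (lieBall n))
    (hF' : DifferentiableOn ℂ F' (lieBall n)) (hm' : Set.MapsTo F' (lieBall n) (lieBall n))
    (hinv : ∀ z ∈ lieBall n, F' (F z) = z) (h0 : F 0 = 0)
    (hR : ∀ x, ‖x‖ < 1 → F (ofRealVec x) ∈ Set.range ofRealVec) :
    (∀ x, ‖fderiv ℂ F 0 (ofRealVec x)‖ = ‖x‖) ∧ ∀ z ∈ lieBall n, F z = fderiv ℂ F 0 z := by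
  have hnhds := (isOpen_lieBall n).mem_nhds (zero_mem_lieBall n)
  have h0' : F' 0 = 0 := by
    have := hinv 0 (zero_mem_lieBall n)
    rwa [h0] at this
  have hcomp : ∀ v, fderiv ℂ F' 0 (fderiv ℂ F 0 v) = v := by
    intro v
    have e1 : HasFDerivAt F (fderiv ℂ F 0) 0 := (hF.differentiableAt hnhds).hasFDerivAt
    have e2 : HasFDerivAt F' (fderiv ℂ F' 0) (F 0) := by
      rw [h0]
      exact (hF'.differentiableAt hnhds).hasFDerivAt
    have e3 := e2.comp 0 e1
    have e4 : F' ∘ F =ᶠ[nhds 0] id := by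
      filter_upwards [hnhds] with z hz
      exact hinv z hz
    have e5 := e3.unique ((hasFDerivAt_id 0).congr_of_eventuallyEq e4)
    exact congrArg (fun L : EuclideanSpace ℂ (Fin n) →L[ℂ] EuclideanSpace ℂ (Fin n) => L v) e5
  have hreal : ∀ x, ∃ y, fderiv ℂ F 0 (ofRealVec x) = ofRealVec y := by
    intro x
    refine ⟨WithLp.toLp 2 fun j => (fderiv ℂ F 0 (ofRealVec x) j).re, ?_⟩
    ext j
    refine Complex.ext ?_ ?_
    · simp [ofRealVec]
    · rw [fderiv_ofRealVec_im hF hR]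
      simp [ofRealVec]
  have hsmul : ∀ (t : ℝ) (x : EuclideanSpace ℝ (Fin n)),
      ofRealVec (t • x) = (t : ℂ) • ofRealVec x := by
    intro t x
    ext j
    simp [ofRealVec]
  have hunit : ∀ x : EuclideanSpace ℝ (Fin n), ‖x‖ = 1 → ‖fderiv ℂ F 0 (ofRealVec x)‖ = 1 := by
    intro x hx
    refine le_antisymm (norm_fderiv_ofRealVec_le hF hm h0 hx) ?_
    obtain ⟨y, hy⟩ := hreal x
    have hy1 := hcomp (ofRealVec x)
    rw [hy] at hy1 ⊢
    have hy0 : ‖y‖ ≠ 0 := by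
      intro h
      have hv : ofRealVec y = 0 := by rwa [← norm_eq_zero, norm_ofRealVec]
      rw [hv, map_zero] at hy1
      rw [← norm_ofRealVec, ← hy1, norm_zero] at hx
      exact zero_ne_one hx
    have hu : ‖(‖y‖⁻¹) • y‖ = 1 := by
      rw [norm_smul, norm_inv, norm_norm, inv_mul_cancel₀ hy0]
    have h3 := norm_fderiv_ofRealVec_le hF' hm' h0' hu
    rw [hsmul, map_smul, hy1, norm_smul, norm_ofRealVec, hx, Complex.norm_real, norm_inv,
      norm_norm, mul_one] at h3
    rw [norm_ofRealVec]
    exact (inv_le_one₀ (lt_of_le_of_ne (norm_nonneg _) (Ne.symm hy0))).1 h3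
  have hscale : ∀ x : EuclideanSpace ℝ (Fin n), x ≠ 0 →
      ∃ u : EuclideanSpace ℝ (Fin n), ‖u‖ = 1 ∧ x = ‖x‖ • u := by
    intro x hx
    have hx0 : ‖x‖ ≠ 0 := norm_ne_zero_iff.2 hx
    refine ⟨‖x‖⁻¹ • x, ?_, ?_⟩
    · rw [norm_smul, norm_inv, norm_norm, inv_mul_cancel₀ hx0]
    · rw [smul_smul, mul_inv_cancel₀ hx0, one_smul]
  have hzero : ofRealVec (0 : EuclideanSpace ℝ (Fin n)) = 0 := by
    ext j
    simp [ofRealVec]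
  refine ⟨fun x => ?_, fun z hz => ?_⟩
  · by_cases hx : x = 0
    · rw [hx, hzero, map_zero, norm_zero, norm_zero]
    · obtain ⟨u, hu, hxu⟩ := hscale x hx
      conv_lhs => rw [hxu]
      rw [hsmul, map_smul, norm_smul, hunit u hu, Complex.norm_real, norm_norm, mul_one]
  -- The real inner product supplies the strict convexity required by the equality case of the
  -- Schwarz lemma.
  · let _ : InnerProductSpace ℝ (EuclideanSpace ℂ (Fin n)) := InnerProductSpace.rclikeToReal ℂ _
    have h1 : DifferentiableOn ℂ (fun z => F z - fderiv ℂ F 0 z) (lieBall n) :=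
      hF.sub (fderiv ℂ F 0).differentiable.differentiableOn
    refine sub_eq_zero.1 (eq_zero_of_eq_zero_on_real h1 (fun x hx => ?_) hz)
    by_cases hx0 : x = 0
    · rw [hx0, hzero, h0, map_zero, sub_zero]
    obtain ⟨u, hu, hxu⟩ := hscale x hx0
    have h2 := Complex.affine_of_mapsTo_ball_of_norm_dslope_eq_div (z₀ := 0)
      (differentiableOn_slice hF hu) (mapsTo_slice hm h0 hu) (Metric.mem_ball_self one_pos)
      (by rw [dslope_same, (hasDerivAt_slice hF _).deriv, hunit u hu, div_one])
    have h3 := h2 (show (‖x‖ : ℂ) ∈ Metric.ball 0 1 by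
      rw [mem_ball_zero_iff, Complex.norm_real, norm_norm]; exact hx)
    simp only [dslope_same, (hasDerivAt_slice hF _).deriv, zero_smul, h0, zero_add,
      sub_zero] at h3
    rw [← map_smul, ← hsmul, ← hxu] at h3
    rw [h3, sub_self]

/-- The derivative at `0` is real and isometric on real vectors, so it is an orthogonal matrix `A`;
the block matrix `diag(1, A)` has factor `1` and acts as `A`. -/
theorem exists_act_of_fixes_zero {n : ℕ} (k : aut n)
    (h0 : (k.1 ⟨0, zero_mem_lieBall n⟩ : EuclideanSpace ℂ (Fin n)) = 0)
    (hk : ∀ x : lieBall n, (x : EuclideanSpace ℂ (Fin n)) ∈ realPart n →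
      (k.1 x : EuclideanSpace ℂ (Fin n)) ∈ realPart n) :
    ∃ g : Matrix (Fin 1 ⊕ Fin n) (Fin 1 ⊕ Fin n) ℝ, IsOrthochronous g ∧
      ∀ z : lieBall n, (k.1 z : EuclideanSpace ℂ (Fin n)) = act g z := by
  obtain ⟨⟨F, hF, hFk⟩, ⟨F', hF', hFk'⟩⟩ := k.2
  have hreal : ∀ x, ‖x‖ < 1 → F (ofRealVec x) ∈ Set.range ofRealVec := by
    intro x hx
    have hx' := ofRealVec_mem_lieBall_iff.2 hx
    have := hk ⟨_, hx'⟩ ⟨hx', x, rfl⟩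
    rw [← hFk] at this
    exact this.2
  obtain ⟨h1, h2⟩ := eq_fderiv_of_fixes_zero hF
    (fun z hz => by rw [hFk ⟨z, hz⟩]; exact (k.1 ⟨z, hz⟩).2) hF'
    (fun z hz => by rw [hFk' ⟨z, hz⟩]; exact (k.1.symm ⟨z, hz⟩).2)
    (fun z hz => by rw [hFk ⟨z, hz⟩, hFk', Homeomorph.symm_apply_apply])
    ((hFk ⟨0, zero_mem_lieBall n⟩).trans h0) hreal
  set L := fderiv ℂ F 0
  set A : Matrix (Fin n) (Fin n) ℝ :=
    Matrix.of fun i j => (L (ofRealVec (EuclideanSpace.single j 1)) i).re with hA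
  have hL : ∀ z i, L z i = ∑ j, (A i j : ℂ) * z j := by
    intro z i
    have e1 : z = ∑ j, z j • ofRealVec (EuclideanSpace.single j 1) := by
      ext l
      simp [ofRealVec, apply_ite Complex.ofReal]
    have e2 : ∀ j, L (ofRealVec (EuclideanSpace.single j 1)) i = (A i j : ℂ) := fun j =>
      Complex.ext (by simp [hA]) (by rw [fderiv_ofRealVec_im hF hreal, Complex.ofReal_im])
    conv_lhs => rw [e1]
    simp [e2, mul_comm]
  have hnorm : ∀ x : Fin n → ℝ, ∑ i, (A *ᵥ x) i ^ 2 = ∑ i, x i ^ 2 := by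
    intro x
    have e1 : L (ofRealVec (WithLp.toLp 2 x)) = ofRealVec (WithLp.toLp 2 (A *ᵥ x)) := by
      ext i
      rw [hL]
      simp [ofRealVec, Matrix.mulVec, dotProduct]
    have e2 := h1 (WithLp.toLp 2 x)
    rw [e1, norm_ofRealVec] at e2
    have e3 := congrArg (· ^ 2) e2
    simpa [EuclideanSpace.norm_sq_eq] using e3
  have hinner : ∀ x y : Fin n → ℝ, ∑ i, (A *ᵥ x) i * (A *ᵥ y) i = ∑ i, x i * y i := by
    intro x y
    have e1 := hnorm (x + y)
    simp only [Matrix.mulVec_add, Pi.add_apply, add_sq, Finset.sum_add_distrib, mul_assoc,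
      ← Finset.mul_sum] at e1
    linarith [hnorm x, hnorm y]
  have hg : IsOrthochronous (Matrix.fromBlocks (1 : Matrix (Fin 1) (Fin 1) ℝ) 0 0 A) := by
    refine ⟨fun x y => ?_, by simp⟩
    simp only [form, Matrix.fromBlocks_mulVec, Sum.elim_inl, Sum.elim_inr, Matrix.one_mulVec,
      Matrix.zero_mulVec, zero_add, add_zero, hinner, Function.comp_apply]
  refine ⟨_, hg, fun z => ?_⟩
  have hf : factor (Matrix.fromBlocks (1 : Matrix (Fin 1) (Fin 1) ℝ) 0 0 A) z = 1 := by
    rw [factor, liftImage_apply]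
    simp
    ring
  rw [← hFk, h2 z z.2]
  ext i
  rw [hL]
  simp [act, hf, liftImage_apply]

/-! ### Transitivity on the real part -/

/-- The Lorentz involution `v ↦ -v + 2 (v|m)/(m|m) m`, where `m = (1, x)`. -/
noncomputable def involution {n : ℕ} (x : EuclideanSpace ℝ (Fin n)) :
    Matrix (Fin 1 ⊕ Fin n) (Fin 1 ⊕ Fin n) ℝ :=
  (2 / (1 - ‖x‖ ^ 2)) • Matrix.vecMulVec (Sum.elim (fun _ => 1) x)
    (lorentz ℝ n *ᵥ Sum.elim (fun _ => 1) x) - 1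

theorem sum_elim_dotProduct_lorentz {n : ℕ} (x : EuclideanSpace ℝ (Fin n)) :
    (Sum.elim (fun _ => 1) x : Fin 1 ⊕ Fin n → ℝ) ⬝ᵥ
      (lorentz ℝ n *ᵥ Sum.elim (fun _ => 1) x) = 1 - ‖x‖ ^ 2 := by
  rw [dotProduct_lorentz_mulVec, EuclideanSpace.norm_sq_eq]
  simp [sq]

theorem involution_mul_self {n : ℕ} {x : EuclideanSpace ℝ (Fin n)} (hx : ‖x‖ < 1) :
    involution x * involution x = 1 := by
  have h : 1 - ‖x‖ ^ 2 ≠ 0 := by nlinarith [norm_nonneg x]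
  rw [involution, sub_mul, mul_sub, Matrix.smul_mul, Matrix.mul_smul,
    Matrix.vecMulVec_mul_vecMulVec, dotProduct_comm, sum_elim_dotProduct_lorentz]
  rw [Matrix.vecMulVec_smul, smul_smul, smul_smul, mul_one, one_mul,
    show 2 / (1 - ‖x‖ ^ 2) * (2 / (1 - ‖x‖ ^ 2)) * (1 - ‖x‖ ^ 2) =
      2 / (1 - ‖x‖ ^ 2) + 2 / (1 - ‖x‖ ^ 2) by field_simp; norm_num, add_smul]
  abel

theorem dotProduct_lorentz_comm {n : ℕ} (x y : Fin 1 ⊕ Fin n → ℝ) :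
    x ⬝ᵥ (lorentz ℝ n *ᵥ y) = y ⬝ᵥ (lorentz ℝ n *ᵥ x) := by
  simp only [dotProduct_lorentz_mulVec, mul_comm]

theorem involution_mulVec {n : ℕ} (x : EuclideanSpace ℝ (Fin n)) (v : Fin 1 ⊕ Fin n → ℝ) :
    involution x *ᵥ v = (2 / (1 - ‖x‖ ^ 2) * (v ⬝ᵥ (lorentz ℝ n *ᵥ Sum.elim (fun _ => 1) x))) •
      (Sum.elim (fun _ => 1) x : Fin 1 ⊕ Fin n → ℝ) - v := by
  rw [involution, Matrix.sub_mulVec, Matrix.one_mulVec, Matrix.smul_mulVec,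
    Matrix.vecMulVec_mulVec, dotProduct_comm v]
  ext i
  simp
  ring

theorem isOrthochronous_involution {n : ℕ} {x : EuclideanSpace ℝ (Fin n)} (hx : ‖x‖ < 1) :
    IsOrthochronous (involution x) := by
  have h : 0 < 1 - ‖x‖ ^ 2 := by nlinarith [norm_nonneg x]
  refine ⟨fun v w => ?_, ?_⟩
  · have hm := sum_elim_dotProduct_lorentz x
    rw [form_eq_dotProduct, form_eq_dotProduct, involution_mulVec, involution_mulVec]
    set m : Fin 1 ⊕ Fin n → ℝ := Sum.elim (fun _ => 1) x
    simp only [Matrix.mulVec_sub, Matrix.mulVec_smul, dotProduct_sub, sub_dotProduct,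
      dotProduct_smul, smul_dotProduct, smul_eq_mul, hm, dotProduct_lorentz_comm m w]
    field_simp
    ring
  · have : involution x (Sum.inl 0) (Sum.inl 0) = (1 + ‖x‖ ^ 2) / (1 - ‖x‖ ^ 2) := by
      simp [involution, Matrix.vecMulVec_apply, lorentz, Matrix.mulVec_diagonal]
      field_simp
      ring
    rw [this]
    positivity

/-- The involution takes `(1, 0)` to `(1 + |x|², 2x)/(1 - |x|²)`. Since `lift 0` is half of `(1,
0)`, the factor is `1/(1 - |x|²)`, leaving exactly `x`. -/
theorem act_involution_zero {n : ℕ} {x : EuclideanSpace ℝ (Fin n)} (hx : ‖x‖ < 1) :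
    act (involution x) 0 = ofRealVec x := by
  have h : 1 - ‖x‖ ^ 2 ≠ 0 := by nlinarith [norm_nonneg x]
  have hc : (((1 - ‖x‖ ^ 2 : ℝ)) : ℂ) ≠ 0 := Complex.ofReal_ne_zero.2 h
  have h00 : involution x (Sum.inl 0) (Sum.inl 0) = (1 + ‖x‖ ^ 2) / (1 - ‖x‖ ^ 2) := by
    simp [involution, Matrix.vecMulVec_apply, lorentz, Matrix.mulVec_diagonal]
    field_simp
    ring
  have hj0 : ∀ j, involution x (Sum.inr j) (Sum.inl 0) = 2 * x j / (1 - ‖x‖ ^ 2) := by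
    intro j
    simp [involution, Matrix.vecMulVec_apply, lorentz, Matrix.mulVec_diagonal]
    field_simp
  have hq : quad (0 : EuclideanSpace ℂ (Fin n)) = 0 := by simp [quad]
  have hf : factor (involution x) 0 = ((1 / (1 - ‖x‖ ^ 2) : ℝ) : ℂ) := by
    rw [factor, liftImage_apply, h00, hq]
    push_cast at hc ⊢
    simp
    field_simp
    ring
  ext j
  simp only [act]
  rw [hf, liftImage_apply, hj0, hq]
  push_cast at hc ⊢
  simp [ofRealVec]
  field_simp

/-- Since `0` is real, so is `h(0)`; the involution exchanging `0` and `h(0)` reduces to an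
automorphism fixing `0`. -/
theorem exists_act_of_preserves_realPart {n : ℕ} (h : aut n)
    (hh : ∀ x : lieBall n, (x : EuclideanSpace ℂ (Fin n)) ∈ realPart n →
      (h.1 x : EuclideanSpace ℂ (Fin n)) ∈ realPart n) :
    ∃ g : Matrix (Fin 1 ⊕ Fin n) (Fin 1 ⊕ Fin n) ℝ, IsOrthochronous g ∧
      ∀ z : lieBall n, (h.1 z : EuclideanSpace ℂ (Fin n)) = act g z := by
  have hzero : (0 : EuclideanSpace ℂ (Fin n)) = ofRealVec 0 := by
    ext j
    simp [ofRealVec]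
  obtain ⟨hm, x, hx⟩ := hh ⟨0, zero_mem_lieBall n⟩ ⟨zero_mem_lieBall n, 0, hzero.symm⟩
  have hx1 : ‖x‖ < 1 := by
    rw [← hx] at hm
    exact ofRealVec_mem_lieBall_iff.1 hm
  have hR := isOrthochronous_involution hx1
  have hRR := involution_mul_self hx1
  set k := actAut _ _ hR hR hRR hRR * h with hk
  have hkz : ∀ z, (k.1 z : EuclideanSpace ℂ (Fin n)) = act (involution x) (h.1 z) := fun _ => rfl
  have hk0 : (k.1 ⟨0, zero_mem_lieBall n⟩ : EuclideanSpace ℂ (Fin n)) = 0 := by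
    rw [hkz, ← hx, ← act_involution_zero hx1, ← act_mul _ hR (zero_mem_lieBall n), hRR, act_one]
  obtain ⟨g, hg, hgk⟩ := exists_act_of_fixes_zero k hk0 fun y hy => by
    rw [hkz]
    exact act_mem_realPart hR (hh y hy)
  refine ⟨involution x * g, hR.mul hg, fun z => ?_⟩
  rw [act_mul _ hg z.2, ← hgk, hkz, ← act_mul _ hR (h.1 z).2, hRR, act_one]

/-! ### Connectedness -/

theorem pos_of_isPreconnected {X : Type*} [TopologicalSpace X] {s : Set X}
    (hs : IsPreconnected s) {f : X → ℝ} (hf : ContinuousOn f s) (hne : ∀ x ∈ s, f x ≠ 0)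
    {a b : X} (ha : a ∈ s) (hb : b ∈ s) (hpos : 0 < f a) : 0 < f b := by
  by_contra hcon
  obtain ⟨c, hc, hc0⟩ := hs.intermediate_value hb ha hf ⟨not_lt.1 hcon, hpos.le⟩
  exact hne c hc hc0

instance (p q : ℕ) : PreconnectedSpace (SOZero p q) :=
  Subtype.preconnectedSpace (isPreconnected_connectedComponent (x := (1 : SO p q)))

theorem isEmbedding_soMat {p q : ℕ} : Topology.IsEmbedding (soMat (p := p) (q := q)) :=
  Topology.IsEmbedding.subtypeVal.comp Topology.IsEmbedding.subtypeVal

/-- The map `f` need only take values in `SO(p,q)` on `s`; this suits `recover` and `shrink`, which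
are defined on whole groups but are meaningful only on a component. -/
theorem mem_SOZero_of_isPreconnected {p q : ℕ} {X : Type*} [TopologicalSpace X] {s : Set X}
    (hs : IsPreconnected s) {f : X → Matrix (Fin p ⊕ Fin q) (Fin p ⊕ Fin q) ℝ} (hf : Continuous f)
    (hdet : ∀ x ∈ s, (f x).det = 1)
    (hform : ∀ x ∈ s, ∀ v w, form p q (f x *ᵥ v) (f x *ᵥ w) = form p q v w)
    {a b : X} (ha : a ∈ s) (hb : b ∈ s) (hfa : f a = 1) :
    ∃ g ∈ SOZero p q, soMat g = f b := by
  let σ : s → SO p q := fun x => ⟨⟨f x, hdet x x.2⟩, hform x x.2⟩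
  have hσ : Continuous σ :=
    ((hf.comp continuous_subtype_val).subtype_mk _).subtype_mk _
  have : PreconnectedSpace s := Subtype.preconnectedSpace hs
  refine ⟨σ ⟨b, hb⟩, ?_, rfl⟩
  have h1 : (1 : SO p q) ∈ Set.range σ := ⟨⟨a, ha⟩, Subtype.ext (Subtype.ext hfa)⟩
  exact (isPreconnected_range hσ).subset_connectedComponent h1 ⟨_, rfl⟩

/-- A continuous homomorphism with an embedding factoring continuously through it is an
isomorphism of topological groups onto its range. -/
noncomputable def rangeEquiv {A B M : Type*} [Group A] [Group B] [TopologicalSpace A]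
    [TopologicalSpace B] [TopologicalSpace M] (Ψ : A →* B) (hΨ : Continuous Ψ) {r : B → M}
    (hr : Continuous r) {i : A → M} (hi : Topology.IsEmbedding i) (h : ∀ a, r (Ψ a) = i a) :
    Ψ.range ≃ₜ* A :=
  have hinj : Function.Injective Ψ := fun a b hab => hi.injective (by rw [← h, hab, h])
  { (MonoidHom.ofInjective hinj).symm with
    continuous_toFun := by
      rw [hi.continuous_iff]
      refine (hr.comp continuous_subtype_val).congr fun x => ?_
      obtain ⟨a, rfl⟩ := (MonoidHom.ofInjective hinj).surjective x
      change r (Ψ a) = i ((MonoidHom.ofInjective hinj).symm (MonoidHom.ofInjective hinj a))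
      rw [MulEquiv.symm_apply_apply, h]
    continuous_invFun := hΨ.subtype_mk _ }

theorem apply_rangeEquiv {A B M : Type*} [Group A] [Group B] [TopologicalSpace A]
    [TopologicalSpace B] [TopologicalSpace M] (Ψ : A →* B) (hΨ : Continuous Ψ) {r : B → M}
    (hr : Continuous r) {i : A → M} (hi : Topology.IsEmbedding i) (h : ∀ a, r (Ψ a) = i a)
    (x : Ψ.range) : Ψ (rangeEquiv Ψ hΨ hr hi h x) = x :=
  have hinj : Function.Injective Ψ := fun a b hab => hi.injective (by rw [← h, hab, h])
  congrArg Subtype.val ((MonoidHom.ofInjective hinj).apply_symm_apply x)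

/-! ### The group `SO₀(1,n)` acting on the Lie ball -/

/-- The corner entry has square at least `1`, so its sign is constant on the component of the
identity. -/
theorem isOrthochronous_of_mem_SOZero {n : ℕ} {g : SO 1 n} (hg : g ∈ SOZero 1 n) :
    IsOrthochronous (soMat g) := by
  refine ⟨g.2, ?_⟩
  have hc : Continuous fun g : SO 1 n => soMat g (Sum.inl 0) (Sum.inl 0) :=
    isEmbedding_soMat.continuous.matrix_elem _ _
  refine pos_of_isPreconnected (f := fun g : SO 1 n => soMat g (Sum.inl 0) (Sum.inl 0))
    isPreconnected_connectedComponent hc.continuousOn (fun x _ => ?_) mem_connectedComponent hg ?_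
  · intro h
    have h1 := col_sq (preserves_form_iff.1 x.2)
    have h2 : 0 ≤ ∑ j, soMat x (Sum.inr j) (Sum.inl 0) ^ 2 :=
      Finset.sum_nonneg fun j _ => sq_nonneg _
    change soMat x (Sum.inl 0) (Sum.inl 0) ^ 2 - ∑ j, soMat x (Sum.inr j) (Sum.inl 0) ^ 2 = 1 at h1
    rw [h] at h1
    linarith
  · simp [soMat]

theorem soMat_mul_inv {p q : ℕ} (g : SO p q) : soMat g * soMat g⁻¹ = 1 := by
  change soMat (g * g⁻¹) = 1
  rw [mul_inv_cancel]
  rfl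

/-- The homomorphism `SO₀(1,n) → Aut(𝓓)`. -/
noncomputable def toAut (n : ℕ) : SOZero 1 n →* aut n where
  toFun g := actAut (soMat g.1) (soMat (g⁻¹).1) (isOrthochronous_of_mem_SOZero g.2)
    (isOrthochronous_of_mem_SOZero (g⁻¹).2) (soMat_mul_inv g.1)
    (mul_eq_one_comm.1 (soMat_mul_inv g.1))
  map_one' := Subtype.ext <| Homeomorph.ext fun _ => Subtype.ext act_one
  map_mul' _ h := Subtype.ext <| Homeomorph.ext fun z => Subtype.ext <|
    act_mul _ (isOrthochronous_of_mem_SOZero h.2) z.2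

theorem toAut_apply {n : ℕ} (g : SOZero 1 n) (z : lieBall n) :
    ((toAut n g).1 z : EuclideanSpace ℂ (Fin n)) = act (soMat g.1) z := rfl

theorem continuous_toAut (n : ℕ) : Continuous (toAut n) := by
  refine continuous_induced_rng.2 (ContinuousMap.continuous_of_continuous_uncurry _ ?_)
  refine Continuous.subtype_mk (f := fun p : SOZero 1 n × lieBall n => act (soMat p.1.1) p.2) ?_ _
  refine continuousOn_act.comp_continuous
    (f := fun p : SOZero 1 n × lieBall n => (soMat p.1.1, (p.2 : EuclideanSpace ℂ (Fin n)))) ?_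
    fun p => ⟨isOrthochronous_of_mem_SOZero p.1.2, p.2.2⟩
  exact (isEmbedding_soMat.continuous.comp (continuous_subtype_val.comp continuous_fst)).prodMk
    (continuous_subtype_val.comp continuous_snd)

/-! ### Recovering a Lorentz matrix from its action -/

/-- For `h` given by a Lorentz matrix `g`, this is `g` applied to `lift z`. -/
noncomputable def transported {n : ℕ} (h : aut n) (z : lieBall n) : Fin 1 ⊕ Fin n → ℂ :=
  ((1 - quad (z : EuclideanSpace ℂ (Fin n))) / (1 - quad (h.1 z : EuclideanSpace ℂ (Fin n)))) •
    lift (h.1 z : EuclideanSpace ℂ (Fin n))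

theorem continuous_eval {n : ℕ} (z : lieBall n) : Continuous fun h : aut n => h.1 z :=
  (ContinuousEvalConst.continuous_eval_const (F := C(lieBall n, lieBall n)) z).comp
    (continuous_induced_dom
      (f := fun f : aut n => (⟨f.1, f.1.continuous⟩ : C(lieBall n, lieBall n))))

theorem continuous_transported {n : ℕ} (z : lieBall n) (k : Fin 1 ⊕ Fin n) :
    Continuous fun h : aut n => transported h z k := by
  have h1 : Continuous fun h : aut n => (h.1 z : EuclideanSpace ℂ (Fin n)) :=
    continuous_subtype_val.comp (continuous_eval z)
  have h2 : Continuous fun h : aut n => quad (h.1 z : EuclideanSpace ℂ (Fin n)) :=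
    differentiable_quad.continuous.comp h1
  refine (continuous_const.div (continuous_const.sub h2) fun h =>
    one_sub_quad_ne_zero (h.1 z).2).mul ?_
  rcases k with k | k
  · simp only [lift, Sum.elim_inl]
    fun_prop
  · simp only [lift, Sum.elim_inr]
    fun_prop

/-- The factor equals `(1 - q(z))/(1 - q(h z))`, so `g` applied to `lift z` is determined by the
value of `h` at `z` alone. -/
theorem transported_eq {n : ℕ} {h : aut n} {g : Matrix (Fin 1 ⊕ Fin n) (Fin 1 ⊕ Fin n) ℝ}
    (hg : IsOrthochronous g) (hh : ∀ z : lieBall n, (h.1 z : EuclideanSpace ℂ (Fin n)) = act g z)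
    (z : lieBall n) : transported h z = liftImage g z := by
  rw [transported, hh, ← factor_smul_lift_act hg z.2, ← factor_mul_one_sub_quad_act hg z.2,
    mul_div_cancel_right₀ _ (one_sub_quad_ne_zero (act_mem_lieBall hg z.2))]

theorem half_single_mem_lieBall {n : ℕ} (j : Fin n) :
    ofRealVec ((1 / 2 : ℝ) • EuclideanSpace.single j 1) ∈ lieBall n := by
  rw [ofRealVec_mem_lieBall_iff, norm_smul, PiLp.norm_single]
  norm_num

/-- The Lorentz matrix inducing an automorphism, if there is one. -/
noncomputable def recover {n : ℕ} (h : aut n) : Matrix (Fin 1 ⊕ Fin n) (Fin 1 ⊕ Fin n) ℝ :=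
  -- `lift` is `(1/2, 0)` at the origin and `(5/8, e_j/2)` at `e_j/2`. These vectors span, and the
  -- coefficients `2` and `5/2` solve for the columns of `g`.
  Matrix.of fun i => Sum.elim (fun _ => 2 * (transported h ⟨0, zero_mem_lieBall n⟩ i).re)
    fun j => 2 * (transported h ⟨_, half_single_mem_lieBall j⟩ i).re -
      5 / 2 * (transported h ⟨0, zero_mem_lieBall n⟩ i).re

theorem continuous_recover (n : ℕ) : Continuous (recover (n := n)) := by
  refine continuous_matrix fun i k => ?_
  have h := fun z => Complex.continuous_re.comp (continuous_transported (n := n) z i)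
  rcases k with k | k
  · exact continuous_const.mul (h _)
  · exact (continuous_const.mul (h _)).sub (continuous_const.mul (h _))

theorem recover_eq {n : ℕ} {h : aut n} {g : Matrix (Fin 1 ⊕ Fin n) (Fin 1 ⊕ Fin n) ℝ}
    (hg : IsOrthochronous g)
    (hh : ∀ z : lieBall n, (h.1 z : EuclideanSpace ℂ (Fin n)) = act g z) : recover h = g := by
  have h0 : ∀ i, (transported h ⟨0, zero_mem_lieBall n⟩ i).re = g i (Sum.inl 0) / 2 := by
    intro i
    rw [transported_eq hg hh, liftImage_apply]
    simp [quad]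
    ring
  have hj : ∀ i j, (transported h ⟨_, half_single_mem_lieBall j⟩ i).re =
      5 / 8 * g i (Sum.inl 0) + g i (Sum.inr j) / 2 := by
    intro i j
    have e : (g i (Sum.inl 0) : ℂ) *
        ((1 + quad (ofRealVec ((1 / 2 : ℝ) • EuclideanSpace.single j 1))) / 2) +
        ∑ l, (g i (Sum.inr l) : ℂ) * ofRealVec ((1 / 2 : ℝ) • EuclideanSpace.single j 1) l =
        ((5 / 8 * g i (Sum.inl 0) + g i (Sum.inr j) / 2 : ℝ) : ℂ) := by
      rw [quad_ofRealVec, norm_smul, PiLp.norm_single]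
      simp [ofRealVec, apply_ite Complex.ofReal]
      ring
    rw [transported_eq hg hh, liftImage_apply, e, Complex.ofReal_re]
  ext i k
  rcases k with k | k
  · rw [Subsingleton.elim k 0]
    simp only [recover, Matrix.of_apply, Sum.elim_inl, h0]
    ring
  · simp only [recover, Matrix.of_apply, Sum.elim_inr, h0, hj]
    ring

theorem recover_toAut {n : ℕ} (g : SOZero 1 n) : recover (toAut n g) = soMat g.1 :=
  recover_eq (isOrthochronous_of_mem_SOZero g.2) fun _ => rfl

theorem range_toAut (n : ℕ) : ((toAut n).range : Set (aut n)) = groupH n := by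
  have hone : (1 : aut n) ∈ groupH n :=
    mem_connectedComponentIn ⟨mem_connectedComponent, fun x hx => hx⟩
  refine Set.Subset.antisymm ?_ fun h hh => ?_
  · have hpre : IsPreconnected ((toAut n).range : Set (aut n)) := by
      rw [MonoidHom.coe_range]
      exact isPreconnected_range (continuous_toAut n)
    -- Membership in `G` is automatic: the range is connected and contains the identity.
    refine hpre.subset_connectedComponentIn (one_mem _) fun h hh =>
      ⟨hpre.subset_connectedComponent (one_mem _) hh, ?_⟩
    obtain ⟨g, rfl⟩ := hh
    intro x hx
    exact act_mem_realPart (isOrthochronous_of_mem_SOZero g.2) hx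
  · have hpre : IsPreconnected (groupH n) := isPreconnected_connectedComponentIn
    have hex : ∀ k ∈ groupH n, IsOrthochronous (recover k) ∧
        ∀ z : lieBall n, (k.1 z : EuclideanSpace ℂ (Fin n)) = act (recover k) z := by
      intro k hk
      obtain ⟨g, hg, hgk⟩ :=
        exists_act_of_preserves_realPart k (connectedComponentIn_subset _ _ hk).2
      rw [recover_eq hg hgk]
      exact ⟨hg, hgk⟩
    have hrec1 : recover (1 : aut n) = 1 := recover_eq IsOrthochronous.one fun z => act_one.symm
    -- The determinant is `±1` and continuous, hence constantly `1` on the connected set `H`.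
    have hdet : ∀ k ∈ groupH n, (recover k).det = 1 := by
      intro k hk
      have hpos : 0 < (recover k).det := by
        refine pos_of_isPreconnected (f := fun k => (recover k).det) hpre
          (continuous_recover n).matrix_det.continuousOn (fun x hx h0 => ?_) hone hk ?_
        · have := (hex x hx).1.det_sq
          rw [h0] at this
          norm_num at this
        · rw [hrec1, Matrix.det_one]
          exact one_pos
      have := (hex k hk).1.det_sq
      nlinarith
    obtain ⟨g, hg, hgh⟩ := mem_SOZero_of_isPreconnected hpre (continuous_recover n) hdet
      (fun k hk => (hex k hk).1.preserves) hone hh hrec1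
    refine ⟨⟨g, hg⟩, Subtype.ext <| Homeomorph.ext fun z => Subtype.ext ?_⟩
    rw [toAut_apply, (hex h hh).2, hgh]

/-! ### The embedding of `SO₀(1,n)` into `SO₀(2,n)` -/

/-- The inclusion of the index set of `SO(1,n)` into that of `SO(2,n)`. -/
def indexEmb (n : ℕ) : Fin 1 ⊕ Fin n → Fin 2 ⊕ Fin n := Sum.map (fun _ => 0) id

/-- The submatrix obtained by deleting the second row and column. -/
def shrink {n : ℕ} (g : SO 2 n) : Matrix (Fin 1 ⊕ Fin n) (Fin 1 ⊕ Fin n) ℝ :=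
  (soMat g).submatrix (indexEmb n) (indexEmb n)

theorem continuous_shrink (n : ℕ) : Continuous (shrink (n := n)) :=
  isEmbedding_soMat.continuous.matrix_submatrix _ _

theorem shrink_theta {n : ℕ} (g : SO 1 n) : shrink (theta n g) = soMat g := by
  ext i j
  change thetaMat (soMat g) (indexEmb n i) (indexEmb n j) = _
  rcases i with i | i <;> rcases j with j | j <;>
    simp [indexEmb, thetaMat, Matrix.toBlocks₂₂, Subsingleton.elim _ (0 : Fin 1)]

theorem continuous_theta (n : ℕ) : Continuous (theta n) := by
  refine (isEmbedding_soMat.continuous_iff).2 (continuous_matrix fun i j => ?_)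
  have h : ∀ i j, Continuous fun g : SO 1 n => soMat g i j := fun i j =>
    isEmbedding_soMat.continuous.matrix_elem i j
  change Continuous fun g => thetaMat (soMat g) i j
  rcases i with i | i <;> rcases j with j | j
  · fin_cases i <;> fin_cases j <;> simp [thetaMat, h, continuous_const]
  · fin_cases i <;> simp [thetaMat, h, continuous_const]
  · fin_cases j <;> simp [thetaMat, h, continuous_const]
  · simp [thetaMat, Matrix.toBlocks₂₂, h]

/-- If `(A + BZ)u = 0` with `u ≠ 0`, then `(u, Zu)` has positive square because `Z ∈ M`, but its
image `(0, ∗)` under `g` has nonpositive square. -/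
theorem det_toBlocks_ne_zero {n : ℕ} (g : SO 2 n) {Z : Matrix (Fin n) (Fin 2) ℝ}
    (hZ : Z ∈ matBall n) : ((soMat g).toBlocks₁₁ + (soMat g).toBlocks₁₂ * Z).det ≠ 0 := by
  intro hdet
  obtain ⟨u, hu0, hu⟩ := Matrix.exists_mulVec_eq_zero_iff.2 hdet
  have h1 := g.2 (Sum.elim u (Z *ᵥ u)) (Sum.elim u (Z *ᵥ u))
  have h2 : g.1.1 *ᵥ Sum.elim u (Z *ᵥ u) =
      Sum.elim (0 : Fin 2 → ℝ) (((soMat g).toBlocks₂₁ + (soMat g).toBlocks₂₂ * Z) *ᵥ u) := by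
    change soMat g *ᵥ _ = _
    conv_lhs => rw [← Matrix.fromBlocks_toBlocks (soMat g)]
    rw [Matrix.fromBlocks_mulVec, ← hu]
    simp [Matrix.add_mulVec, Matrix.mulVec_mulVec]
  rw [h2] at h1
  have h3 := hZ.dotProduct_mulVec_pos hu0
  rw [star_trivial, Matrix.sub_mulVec, Matrix.one_mulVec, ← Matrix.mulVec_mulVec, dotProduct_sub,
    Matrix.dotProduct_mulVec u Zᵀ, Matrix.vecMul_transpose] at h3
  simp only [form, Sum.elim_inl, Sum.elim_inr, Pi.zero_apply, mul_zero, Finset.sum_const_zero] at h1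
  have h4 : 0 ≤ ∑ j, (((soMat g).toBlocks₂₁ + (soMat g).toBlocks₂₂ * Z) *ᵥ u) j *
      (((soMat g).toBlocks₂₁ + (soMat g).toBlocks₂₂ * Z) *ᵥ u) j :=
    Finset.sum_nonneg fun j _ => mul_self_nonneg _
  simp only [dotProduct] at h3
  linarith

/-- The second basis vector. -/
def secondVec (n : ℕ) : Fin 2 ⊕ Fin n → ℝ := Sum.elim ![0, 1] 0

/-- With `N = A + BZ` and `P = C + DZ`, the vector `u = N⁻¹e₂` has `Nu = e₂`, and `Pu = 0` because
the second column of `PN⁻¹ = (X' 0)` vanishes. Thus `g(u, Zu) = e₂`, and `Zu = u₀X`. -/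
theorem exists_mulVec_eq_secondVec {n : ℕ} (g : SO 2 n) {X X' : EuclideanSpace ℝ (Fin n)}
    (hX : colZero X ∈ matBall n) (h : mobius g (colZero X) = colZero X') :
    ∃ u : Fin 2 → ℝ, soMat g *ᵥ Sum.elim u (u 0 • X) = secondVec n := by
  have hdet := det_toBlocks_ne_zero g hX
  set N := (soMat g).toBlocks₁₁ + (soMat g).toBlocks₁₂ * colZero X with hN
  set P := (soMat g).toBlocks₂₁ + (soMat g).toBlocks₂₂ * colZero X with hP
  have h' : P * N⁻¹ = colZero X' := h
  refine ⟨N⁻¹ *ᵥ ![0, 1], ?_⟩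
  set u := N⁻¹ *ᵥ ![0, 1] with hu
  have h1 : N *ᵥ u = ![0, 1] := by
    rw [hu, Matrix.mulVec_mulVec, Matrix.mul_nonsing_inv _ (isUnit_iff_ne_zero.2 hdet),
      Matrix.one_mulVec]
  have h2 : P *ᵥ u = 0 := by
    rw [hu, Matrix.mulVec_mulVec, h']
    ext i
    simp [colZero, Matrix.mulVec, dotProduct]
  have h3 : u 0 • X.ofLp = colZero X *ᵥ u := by
    ext i
    simp [colZero, Matrix.mulVec, dotProduct, mul_comm]
  clear_value u
  conv_lhs => rw [← Matrix.fromBlocks_toBlocks (soMat g)]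
  rw [Matrix.fromBlocks_mulVec, secondVec, ← h1, ← h2]
  change Sum.elim (_ *ᵥ u + _ *ᵥ (u 0 • X.ofLp))
    (_ *ᵥ u + _ *ᵥ (u 0 • X.ofLp)) = _
  rw [h3, hN, hP, Matrix.add_mulVec, Matrix.add_mulVec, Matrix.mulVec_mulVec,
    Matrix.mulVec_mulVec]

/-- The preimage of `e₂` under `g` has the form `(u, u₀X)` for every `X`. Comparing `X = 0` with one
nonzero `X` gives `u₀ = 0`, so the preimage is a multiple of `e₂`, of square `1`. -/
theorem mulVec_secondVec {n : ℕ} (hn : 0 < n) {g : SO 2 n}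
    (hg : ∀ x ∈ realPart n, ∃ y ∈ realPart n, hua y = mobius g (hua x)) :
    ∃ t : ℝ, t ^ 2 = 1 ∧ soMat g *ᵥ secondVec n = t • secondVec n := by
  have key : ∀ X : EuclideanSpace ℝ (Fin n), ‖X‖ < 1 →
      ∃ u : Fin 2 → ℝ, soMat g *ᵥ Sum.elim u (u 0 • X) = secondVec n := by
    intro X hX
    have h1 : colZero X ∈ hua '' realPart n := by
      rw [hua_image_realPart]
      exact ⟨X, hX, rfl⟩
    obtain ⟨x, hx, hxX⟩ := h1
    obtain ⟨y, hy, hyx⟩ := hg x hx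
    have h2 : hua y ∈ hua '' realPart n := ⟨y, hy, rfl⟩
    rw [hua_image_realPart] at h2
    obtain ⟨X', -, hX'⟩ := h2
    have hM := hua_mem_matBall hx.1
    rw [hxX] at hyx hM
    exact exists_mulVec_eq_secondVec g hM (X' := X') (by rw [← hyx, hX'])
  obtain ⟨u, hu⟩ := key 0 (by simp)
  obtain ⟨v, hv⟩ := key ((1 / 2 : ℝ) • EuclideanSpace.single ⟨0, hn⟩ 1) (by
    rw [norm_smul, PiLp.norm_single]
    norm_num)
  have hinj : Function.Injective fun w => soMat g *ᵥ w := by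
    intro a b hab
    have h1 : soMat g⁻¹ * soMat g = 1 := mul_eq_one_comm.1 (soMat_mul_inv g)
    have h2 := congrArg (soMat g⁻¹ *ᵥ ·) hab
    simpa [Matrix.mulVec_mulVec, h1] using h2
  have huv := hinj (hu.trans hv.symm)
  have h0 : u 0 = 0 := by
    have e1 := congrFun huv (Sum.inl 0)
    have e2 := congrFun huv (Sum.inr ⟨0, hn⟩)
    simp at e1 e2
    rw [e1, e2]
  have h1 : Sum.elim u (u 0 • (0 : EuclideanSpace ℝ (Fin n)).ofLp) = u 1 • secondVec n := by
    ext k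
    rcases k with k | k
    · fin_cases k <;> simp [secondVec, h0]
    · simp [secondVec]
  rw [h1] at hu
  have h2 : u 1 ^ 2 = 1 := by
    have e := g.2 (u 1 • secondVec n) (u 1 • secondVec n)
    change form 2 n (soMat g *ᵥ _) (soMat g *ᵥ _) = _ at e
    rw [hu] at e
    simp [form, secondVec] at e
    rw [sq, ← e]
  refine ⟨u 1, h2, ?_⟩
  rw [Matrix.mulVec_smul] at hu
  conv_rhs => rw [← hu]
  rw [smul_smul, ← sq, h2, one_smul]

/-- The second column is `e₂` by hypothesis; pairing the images of the other basis vectors with the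
fixed `e₂` shows that the second row is `e₂` too. -/
theorem soMat_eq_thetaMat {n : ℕ} {g : SO 2 n} (h : soMat g *ᵥ secondVec n = secondVec n) :
    soMat g = thetaMat (shrink g) := by
  have hcol : ∀ k, soMat g k (Sum.inl 1) = secondVec n k := by
    intro k
    rw [← h]
    simp [Matrix.mulVec, dotProduct, secondVec]
  have hrow : ∀ k, soMat g (Sum.inl 1) k = secondVec n k := by
    intro k
    have e := g.2 (Pi.single k 1) (secondVec n)
    change form 2 n (soMat g *ᵥ _) (soMat g *ᵥ _) = _ at e
    rw [h] at e
    rcases k with k | k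
    · fin_cases k <;> simpa [form, secondVec] using e
    · simpa [form, secondVec] using e
  ext i j
  rcases i with i | i <;> rcases j with j | j
  · fin_cases i <;> fin_cases j <;> simp [thetaMat, shrink, indexEmb, hcol, hrow, secondVec]
  · fin_cases i <;> simp [thetaMat, shrink, indexEmb, hrow, secondVec]
  · fin_cases j <;> simp [thetaMat, shrink, indexEmb, hcol, secondVec]
  · simp [thetaMat, shrink, indexEmb, Matrix.toBlocks₂₂]

theorem form_shrink {n : ℕ} {g : SO 2 n} (h : soMat g = thetaMat (shrink g))
    (x y : Fin 1 ⊕ Fin n → ℝ) :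
    form 1 n (shrink g *ᵥ x) (shrink g *ᵥ y) = form 1 n x y := by
  let e : (Fin 1 ⊕ Fin n → ℝ) → Fin 2 ⊕ Fin n → ℝ := fun x =>
    Sum.elim ![x (Sum.inl 0), 0] fun j => x (Sum.inr j)
  have h1 : ∀ x y, form 2 n (e x) (e y) = form 1 n x y := by
    intro x y
    simp [form, e]
  have h2 : ∀ x, thetaMat (shrink g) *ᵥ e x = e (shrink g *ᵥ x) := by
    intro x
    ext k
    rcases k with k | k
    · fin_cases k <;> simp [e, thetaMat, Matrix.mulVec, dotProduct]
    · simp [e, thetaMat, Matrix.mulVec, dotProduct, Matrix.toBlocks₂₂]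
  rw [← h1, ← h1, ← h2, ← h2, ← h]
  exact g.2 _ _

/-- The restriction of `θ` to `SO₀(1,n)`. -/
noncomputable def thetaZero (n : ℕ) : SOZero 1 n →* SO 2 n := (theta n).comp (SOZero 1 n).subtype

theorem continuous_thetaZero (n : ℕ) : Continuous (thetaZero n) :=
  (continuous_theta n).comp continuous_subtype_val

theorem range_thetaZero {n : ℕ} (hn : 0 < n) : ((thetaZero n).range : Set (SO 2 n)) =
    connectedComponentIn
      {g | g ∈ SOZero 2 n ∧ ∀ x ∈ realPart n, ∃ y ∈ realPart n,
        hua y = mobius g (hua x)} 1 := by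
  have hpre : IsPreconnected ((thetaZero n).range : Set (SO 2 n)) := by
    rw [MonoidHom.coe_range]
    exact isPreconnected_range (continuous_thetaZero n)
  have hsub : ((thetaZero n).range : Set (SO 2 n)) ⊆
      {g | g ∈ SOZero 2 n ∧ ∀ x ∈ realPart n, ∃ y ∈ realPart n,
        hua y = mobius g (hua x)} := by
    intro g hg
    refine ⟨hpre.subset_connectedComponent (one_mem _) hg, fun x hx => ?_⟩
    obtain ⟨g, rfl⟩ := hg
    have hg := isOrthochronous_of_mem_SOZero g.2
    exact ⟨act (soMat g.1) x, act_mem_realPart hg hx, hua_act hg hx.1⟩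
  have hone := mem_connectedComponentIn (hsub (one_mem _))
  refine Set.Subset.antisymm (hpre.subset_connectedComponentIn (one_mem _) hsub) fun g hg => ?_
  set C := connectedComponentIn {g | g ∈ SOZero 2 n ∧ ∀ x ∈ realPart n, ∃ y ∈ realPart n,
    hua y = mobius g (hua x)} (1 : SO 2 n)
  have hC : IsPreconnected C := isPreconnected_connectedComponentIn
  have hentry : ∀ k : SO 2 n, (soMat k *ᵥ secondVec n) (Sum.inl 1) = soMat k (Sum.inl 1) (Sum.inl 1) := by
    intro k
    simp [Matrix.mulVec, dotProduct, secondVec]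
  have hfix : ∀ k ∈ C, soMat k = thetaMat (shrink k) := by
    intro k hk
    apply soMat_eq_thetaMat
    have hex : ∀ k ∈ C, ∃ t : ℝ, t ^ 2 = 1 ∧ soMat k *ᵥ secondVec n = t • secondVec n ∧
        soMat k (Sum.inl 1) (Sum.inl 1) = t := by
      intro k hk
      obtain ⟨t, ht, hkt⟩ := mulVec_secondVec hn (connectedComponentIn_subset _ _ hk).2
      refine ⟨t, ht, hkt, ?_⟩
      rw [← hentry, hkt]
      simp [secondVec]
    -- On `C` this entry is the sign by which `e₂` is multiplied; continuity from the identity keeps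
    -- it positive.
    have hpos : 0 < soMat k (Sum.inl 1) (Sum.inl 1) := by
      refine pos_of_isPreconnected (f := fun k : SO 2 n => soMat k (Sum.inl 1) (Sum.inl 1)) hC
        (isEmbedding_soMat.continuous.matrix_elem _ _).continuousOn (fun x hx h0 => ?_) hone hk ?_
      · obtain ⟨t, ht, -, ht'⟩ := hex x hx
        rw [← ht', h0] at ht
        norm_num at ht
      · simp [soMat]
    obtain ⟨t, ht, hkt, ht'⟩ := hex k hk
    rw [ht'] at hpos
    have : t = 1 := by nlinarith
    rw [hkt, this, one_smul]
  have hone' : shrink (1 : SO 2 n) = 1 := by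
    rw [← map_one (theta n), shrink_theta]
    rfl
  obtain ⟨k, hk, hkg⟩ := mem_SOZero_of_isPreconnected hC (continuous_shrink n)
    (fun k hk => by rw [← thetaMat_det, ← hfix k hk]; exact k.1.2)
    (fun k hk => form_shrink (hfix k hk)) hone hg hone'
  refine ⟨⟨k, hk⟩, isEmbedding_soMat.injective ?_⟩
  change thetaMat (soMat k) = soMat g
  rw [hkg, ← hfix g hg]

end LieBall

theorem mainTheorem8 (n : ℕ) (hn : 2 < n) :
    -- the Hua transform is a bijection of the Lie ball onto `M`
    Set.BijOn LieBall.hua (LieBall.lieBall n) (LieBall.matBall n) ∧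
    -- it maps the real part onto `{(X 0) | |X| < 1}`
    LieBall.hua '' LieBall.realPart n =
      {Z | ∃ X : EuclideanSpace ℝ (Fin n), ‖X‖ < 1 ∧ Z = LieBall.colZero X} ∧
    -- diffeomorphically, by `x ↦ 2x / (1 + |x|²)`
    (∃ φ : OpenPartialHomeomorph (EuclideanSpace ℝ (Fin n)) (EuclideanSpace ℝ (Fin n)),
      φ.source = {x | LieBall.ofRealVec x ∈ LieBall.lieBall n} ∧
      φ.target = {X | ‖X‖ < 1} ∧
      ContDiffOn ℝ ∞ φ φ.source ∧
      ContDiffOn ℝ ∞ φ.symm φ.target ∧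
      ∀ x ∈ φ.source, φ x = (2 / (1 + ‖x‖ ^ 2)) • x ∧
        LieBall.hua (LieBall.ofRealVec x) = LieBall.colZero (φ x)) ∧
    -- `H` is a group and `h ↦ 𝓗 h 𝓗⁻¹` is an isomorphism of `H` onto `SO₀(1,n)`,
    -- which acts on `M` as a subgroup of `SO(2,n)`; here `G = Aut(𝓓)₀`
    (∃ H : Subgroup (LieBall.aut n), (H : Set (LieBall.aut n)) = LieBall.groupH n ∧
      ∃ Φ : H ≃ₜ* LieBall.SOZero 1 n, ∀ (h : H) (z : LieBall.lieBall n),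
        LieBall.hua (h.1.1 z) =
          LieBall.mobius (LieBall.theta n (Φ h).1) (LieBall.hua z)) ∧
    -- the same for `G = SO₀(2,n)` acting on the Lie ball by `z ↦ 𝓗⁻¹(g 𝓗(z))`
    (∃ H : Subgroup (LieBall.SO 2 n),
      (H : Set (LieBall.SO 2 n)) =
        connectedComponentIn
          {g | g ∈ LieBall.SOZero 2 n ∧ ∀ x ∈ LieBall.realPart n, ∃ y ∈ LieBall.realPart n,
            LieBall.hua y = LieBall.mobius g (LieBall.hua x)} 1 ∧
      ∃ Φ : H ≃ₜ* LieBall.SOZero 1 n, ∀ h : H, LieBall.theta n (Φ h).1 = h.1) := by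
  have hemb : Topology.IsEmbedding fun g : LieBall.SOZero 1 n => LieBall.soMat g.1 :=
    LieBall.isEmbedding_soMat.comp Topology.IsEmbedding.subtypeVal
  refine ⟨LieBall.hua_bijOn n, LieBall.hua_image_realPart n, ⟨LieBall.ballDiffeo n, ?_, rfl,
    LieBall.contDiffOn_ballDiffeo n, LieBall.contDiffOn_ballDiffeo_symm n,
    fun x hx => ⟨rfl, LieBall.hua_ofRealVec hx⟩⟩,
    ⟨(LieBall.toAut n).range, LieBall.range_toAut n,
      LieBall.rangeEquiv _ (LieBall.continuous_toAut n) (LieBall.continuous_recover n) hemb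
        LieBall.recover_toAut, fun h z => ?_⟩,
    ⟨(LieBall.thetaZero n).range, LieBall.range_thetaZero (by omega),
      LieBall.rangeEquiv _ (LieBall.continuous_thetaZero n) (LieBall.continuous_shrink n) hemb
        fun g => LieBall.shrink_theta g.1, fun h => ?_⟩⟩
  · ext x
    exact LieBall.ofRealVec_mem_lieBall_iff.symm
  · set Φ := LieBall.rangeEquiv _ (LieBall.continuous_toAut n) (LieBall.continuous_recover n) hemb
      LieBall.recover_toAut
    rw [← LieBall.hua_act (LieBall.isOrthochronous_of_mem_SOZero (Φ h).2) z.2,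
      ← LieBall.toAut_apply, LieBall.apply_rangeEquiv]
  · exact LieBall.apply_rangeEquiv (LieBall.thetaZero n) _ _ _ _ h
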